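/- Let $K$ be a local field of characteristic $t>0$ with ring of integers $\mathfrak D=\{|x|\le1\}$, prime ideal $\mathfrak B=\{|x|<1\}$, prime element $\mathfrak p$ and residue field $\mathfrak D/\mathfrak B\cong GF(q)$, $q=t^c$, and let $dx$ be the Haar measure of $K$ with $|\mathfrak D|=1$. Fix $1=\zeta_0,\zeta_1,\dots,\zeta_{c-1}$ of absolute value $1$ whose span over $GF(t)$ is a subfield of $K$ mapped bijectively onto $\mathfrak D/\mathfrak B$. For $0\le n<q$, $n=a_0+a_1t+\dots+a_{c-1}t^{c-1}$ with $0\le a_i<t$, put $u(n)=(a_0+a_1\zeta_1+\dots+a_{c-1}\zeta_{c-1})\mathfrak p^{-1}$, and for $n=b_0+b_1q+\dots+b_sq^s$ with $0\le b_i<q$ put $u(n)=\sum_{i=0}^s u(b_i)\mathfrak p^{-i}$. Let $\chi$ be the character of $K^+$ that is trivial on $\mathfrak D$ and satisfies $\chi(\zeta_i\mathfrak p^{-j})=e^{2\pi i/t}$ (with $i=\sqrt{-1}$ in the exponent) if $(i,j)=(0,1)$ and $\chi(\zeta_i\mathfrak p^{-j})=1$ otherwise ($0\le i<c$, $j\in\mathbb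 Z$); write $\chi_y(x)=\chi(yx)$, and let $\hat f(\xi)=\int_K f(x)\overline{\chi(\xi x)}\,dx$, extended to $L^2(K)$. For a finite family $\Psi=\{\psi_i\}\subset L^2(K)$ let $\mathcal F(\Psi)$ consist of the functions $\psi_{i,j,k}(x)=q^{j/2}\psi_i(\mathfrak p^{-j}x-u(k))$, $j\in\mathbb Z$, $k\in\mathbb N_0$. It is a tight wavelet frame for $L^2(K)$ if there is a constant $a>0$ with $\sum_{i,j,k}|\langle f,\psi_{i,j,k}\rangle|^2=a\|f\|_2^2$ for all $f\in L^2(K)$, and a normalized one if this holds with $a=1$. Two such systems $\mathcal F(\Psi)$, $\mathcal F(\Phi)$, with families indexed by the same set, are orthogonal if $\sum_{i,j,k}\langle f,\psi_{i,j,k}\rangle\phi_{i,j,k}=0$ in $L^2(K)$ for all $f\in L^2(K)$. Let $\varphi\in L^2(K)$ and $\psi_1,\dots,\psi_N\in L^2(K)$ satisfy $$\varphi(x)=\sqrt q\sum_{k\in\mathbb N_0}d^0_k\,\varphi(\mathfrak p^{-1}x-u(k)),\qquad \psi_n(x)=\sqrt q\sum_{k\in\mathbb N_0}d^n_k\,\varphi(\mathfrak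 p^{-1}x-u(k))\quad(1\le n\le N)$$ with convergence in $L^2(K)$, and let $m_n(\xi)=\frac1{\sqrt q}\sum_{k\in\mathbb N_0}d^n_k\overline{\chi_{u(k)}(\xi)}$, $0\le n\le N$, be the masks, where the series converge in $L^2$ on every ball (in particular, Walsh polynomials, with finitely many $d^n_k\ne0$, are allowed). Assume that for every $k=1,\dots,q-1$ the $(N+1)\times2$ matrix $\mathcal M(\xi)$ with rows $(m_n(\xi),\,m_n(\xi+\mathfrak pu(k)))$, $n=0,\dots,N$, satisfies $\mathcal M^*(\xi)\mathcal M(\xi)=I_2$ for a.e. $\xi$, and that $\mathcal F(\{\psi_1,\dots,\psi_N\})$ is a normalized wavelet frame for $L^2(K)$. Let $A(\xi)=(a_{\ell,r}(\xi))$ be an $L\times L$ paraunitary matrix, that is, measurable in $\xi\in K$ and unitary for a.e. $\xi$, whose entries are integral periodic in the sense that for all $k\in\mathbb N_0$, $a_{\ell,r}(\xi+\mathfrak pu(k))=a_{\ell,r}(\xi)$ for a.e. $\xi$ (the $\mathfrak pu(k)$ are the polynomials in $\mathfrak p^{-1}$ with coefficients in the copy of $GF(q)$ spanned by the $\zeta_i$).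 For $1\le r,\ell\le L$ and $1\le n\le N$ put $\eta^r_{n,\ell}=a_{\ell,r}\,m_n$. Then there are functions $\psi^r_{n,\ell}\in L^2(K)$ with $$\hat\psi^r_{n,\ell}(\mathfrak p^{-1}\xi)=\eta^r_{n,\ell}(\xi)\,\hat\varphi(\xi)\quad\text{for a.e. }\xi,$$ and for any such functions, with $\Psi^r=\{\psi^r_{n,\ell}:1\le n\le N,\ 1\le\ell\le L\}$, each $\mathcal F(\Psi^r)$, $r=1,\dots,L$, is a tight wavelet frame for $L^2(K)$, and $\mathcal F(\Psi^r)$ and $\mathcal F(\Psi^{r'})$ are orthogonal whenever $r\ne r'$. -/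

import Mathlib

noncomputable section

namespace LocalFieldWavelet

open MeasureTheory Filter Topology

/-- The choices fixed once and for all on a local field `K` of characteristic `t > 0` whose
residue field has `q = t ^ c` elements.  The ring of integers is `{x | ‖x‖ ≤ 1}`, the prime ideal
is `{x | ‖x‖ < 1}`. -/
structure Setup (K : Type*) [NontriviallyNormedField K] (t c : ℕ) [NeZero c] where
  /-- the prime element: an element of maximal absolute value in the prime ideal -/
  ϖ : K
  ϖ_lt_one : ‖ϖ‖ < 1
  ϖ_max : ∀ x : K, ‖x‖ < 1 → ‖x‖ ≤ ‖ϖ‖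
  /-- units `1 = ζ₀, …, ζ_{c-1}` whose span over the prime field is a copy of `GF(q)` in `K` -/
  ζ : Fin c → K
  ζ_zero : ζ 0 = 1
  ζ_norm : ∀ i, ‖ζ i‖ = 1
  span_subfield : ∃ F : Subfield K,
    (F : Set K) = Set.range fun a : Fin c → Fin t => ∑ i, ((a i : ℕ) : K) * ζ i
  /-- the span of the `ζ i` is a full set of representatives of the residue field, and the
  coordinates are unique, so the residue field has `t ^ c` elements -/
  residue : ∀ x : K, ‖x‖ ≤ 1 →
    ∃! a : Fin c → Fin t, ‖x - ∑ i, ((a i : ℕ) : K) * ζ i‖ < 1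
  /-- the fixed additive character -/
  χ : AddChar K Circle
  χ_continuous : Continuous χ
  χ_integers : ∀ x : K, ‖x‖ ≤ 1 → χ x = 1
  χ_value : ∀ (i : Fin c) (j : ℤ), (χ (ζ i * ϖ ^ (-j)) : ℂ) =
    if i = 0 ∧ j = 1 then Complex.exp (2 * Real.pi * Complex.I / t) else 1

/-- `⟨f, g⟩ = ∫ f(x) conj(g(x)) dx`. -/
def innerL2 {K : Type*} [MeasurableSpace K] (μ : Measure K) (f g : K → ℂ) : ℂ :=
  ∫ x, f x * starRingEnd ℂ (g x) ∂μ

namespace Setup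

variable {K : Type*} [NontriviallyNormedField K] {t c : ℕ} [NeZero c] (W : Setup K t c)

/-- The number of elements of the residue field, as a real number. -/
def q (_W : Setup K t c) : ℝ := (t : ℝ) ^ c

/-- For `b = a₀ + a₁ t + ⋯ + a_{c-1} t^{c-1}` with `0 ≤ aᵢ < t`, the element
`a₀ + a₁ ζ₁ + ⋯ + a_{c-1} ζ_{c-1}`. -/
def digit (b : ℕ) : K := ∑ i : Fin c, ((b / t ^ (i : ℕ) % t : ℕ) : K) * W.ζ i

/-- `u(n) = u(b₀) + u(b₁) ϖ⁻¹ + ⋯ + u(b_s) ϖ^{-s}` for `n = b₀ + b₁ q + ⋯ + b_s q^s` in base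
`q = t ^ c`, where `u(b) = digit(b) ϖ⁻¹` for `0 ≤ b < q`.  The base-`q` digits of `n` at
positions greater than `n` vanish. -/
def u (n : ℕ) : K :=
  ∑ j ∈ Finset.range (n + 1), W.digit (n / (t ^ c) ^ j % t ^ c) * W.ϖ⁻¹ * W.ϖ⁻¹ ^ j

/-- `ψ_{j,k}(x) = q^{j/2} ψ(ϖ^{-j} x - u(k))`. -/
def dilate (ψ : K → ℂ) (j : ℤ) (k : ℕ) : K → ℂ := fun x =>
  ((W.q ^ ((j : ℝ) / 2) : ℝ) : ℂ) * ψ (W.ϖ ^ (-j) * x - W.u k)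

/-- The combined mask matrix with rows `(m_n(ξ), m_n(ξ + ϖ u(k)))`. -/
def maskMatrix {N : ℕ} (m : Fin (N + 1) → K → ℂ) (k : ℕ) (ξ : K) :
    Matrix (Fin (N + 1)) (Fin 2) ℂ :=
  Matrix.of fun n i => if i = 0 then m n ξ else m n (ξ + W.ϖ * W.u k)

/-- The masks `η^r_{n,ℓ} = a_{ℓ,r} m_n`, `1 ≤ n ≤ N`, `1 ≤ ℓ ≤ L`. -/
def newMask {N L : ℕ} (A : K → Matrix (Fin L) (Fin L) ℂ) (m : Fin (N + 1) → K → ℂ)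
    (r : Fin L) (i : Fin N × Fin L) : K → ℂ := fun ξ =>
  A ξ i.2 r * m i.1.succ ξ

variable [MeasurableSpace K] (μ : Measure K)

/-- The integral `∫ f(x) conj(χ(ξ x)) dx`. -/
def fourierIntegral (f : K → ℂ) (ξ : K) : ℂ :=
  ∫ x, f x * starRingEnd ℂ (W.χ (ξ * x) : ℂ) ∂μ

/-- `g` is the Fourier transform of `f ∈ L²(K)`: the `L²`-extension of the integral transform from
`L¹(K) ∩ L²(K)`. -/
def IsFourierL2 (f g : K → ℂ) : Prop :=
  MemLp f 2 μ ∧ MemLp g 2 μ ∧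
    ∃ s : ℕ → K → ℂ, (∀ n, Integrable (s n) μ ∧ MemLp (s n) 2 μ) ∧
      Tendsto (fun n => eLpNorm (s n - f) 2 μ) atTop (𝓝 0) ∧
      Tendsto (fun n => eLpNorm (W.fourierIntegral μ (s n) - g) 2 μ) atTop (𝓝 0)

/-- `m(ξ) = q^{-1/2} ∑_k d_k conj(χ_{u(k)}(ξ))`, with convergence in `L²` on every ball.  If `d`
has finite support then `m` is a Walsh polynomial. -/
def IsMask (d : ℕ → ℂ) (m : K → ℂ) : Prop :=
  AEStronglyMeasurable m μ ∧
    ∀ R : ℝ, Tendsto (fun n => eLpNorm (fun ξ => m ξ - ((1 / √W.q : ℝ) : ℂ) *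
        ∑ k ∈ Finset.range n, d k * starRingEnd ℂ (W.χ (W.u k * ξ) : ℂ)) 2
      (μ.restrict (Metric.closedBall 0 R))) atTop (𝓝 0)

/-- `f(x) = √q ∑_k d_k φ(ϖ⁻¹ x - u(k))`, with convergence in `L²(K)`. -/
def TwoScale (φ : K → ℂ) (d : ℕ → ℂ) (f : K → ℂ) : Prop :=
  Tendsto (fun n => eLpNorm (fun x => f x - ((√W.q : ℝ) : ℂ) *
    ∑ k ∈ Finset.range n, d k * φ (W.ϖ⁻¹ * x - W.u k)) 2 μ) atTop (𝓝 0)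

/-- The wavelet system of `Ψ ⊂ L²(K)` is a frame of `L²(K)` with bounds `a` and `b`:
`a ‖f‖² ≤ ∑_{i,j,k} |⟨f, ψ_{i,j,k}⟩|² ≤ b ‖f‖²` for all `f ∈ L²(K)`. -/
def HasFrameBounds {ι : Type*} (Ψ : ι → K → ℂ) (a b : ℝ) : Prop :=
  (∀ i, MemLp (Ψ i) 2 μ) ∧ ∀ f : K → ℂ, MemLp f 2 μ →
    Summable (fun p : ι × ℤ × ℕ => ‖innerL2 μ f (W.dilate (Ψ p.1) p.2.1 p.2.2)‖ ^ 2) ∧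
    a * ∫ x, ‖f x‖ ^ 2 ∂μ ≤
      ∑' p : ι × ℤ × ℕ, ‖innerL2 μ f (W.dilate (Ψ p.1) p.2.1 p.2.2)‖ ^ 2 ∧
    ∑' p : ι × ℤ × ℕ, ‖innerL2 μ f (W.dilate (Ψ p.1) p.2.1 p.2.2)‖ ^ 2 ≤
      b * ∫ x, ‖f x‖ ^ 2 ∂μ

/-- Tight wavelet frame: the two frame bounds can be taken equal. -/
def IsTightFrame {ι : Type*} (Ψ : ι → K → ℂ) : Prop :=
  ∃ a : ℝ, 0 < a ∧ W.HasFrameBounds μ Ψ a a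

/-- Normalized (tight), that is Parseval, wavelet frame. -/
def IsNormalizedFrame {ι : Type*} (Ψ : ι → K → ℂ) : Prop :=
  W.HasFrameBounds μ Ψ 1 1

/-- Orthogonality of two wavelet systems: `∑_{i,j,k} ⟨f, ψ_{i,j,k}⟩ φ_{i,j,k} = 0` for all
`f ∈ L²(K)`, with unconditional convergence in `L²(K)`. -/
def AreOrthogonal {ι : Type*} (Ψ Φ : ι → K → ℂ) : Prop :=
  ∀ f : K → ℂ, MemLp f 2 μ →
    Tendsto (fun s : Finset (ι × ℤ × ℕ) => eLpNorm (fun x => ∑ p ∈ s,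
      innerL2 μ f (W.dilate (Ψ p.1) p.2.1 p.2.2) * W.dilate (Φ p.1) p.2.1 p.2.2 x) 2 μ)
      atTop (𝓝 0)

/-- Paraunitary matrix function: measurable entries, unitary at almost every point. -/
def IsParaunitary {L : ℕ} (A : K → Matrix (Fin L) (Fin L) ℂ) : Prop :=
  (∀ ℓ r, AEStronglyMeasurable (fun ξ => A ξ ℓ r) μ) ∧
    ∀ᵐ ξ ∂μ, A ξ ∈ Matrix.unitaryGroup (Fin L) ℂ

/-- Integral periodicity: `f(ξ + ϖ u(k)) = f(ξ)` for all `k`.  The elements `ϖ u(k)` are exactly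
the polynomials in `ϖ⁻¹` with coefficients in `GF(q)`, the integers of `K`. -/
def IsIntegralPeriodic (f : K → ℂ) : Prop :=
  ∀ k : ℕ, ∀ᵐ ξ ∂μ, f (ξ + W.ϖ * W.u k) = f ξ

end Setup

end LocalFieldWavelet

end

/-! Write Λ for the group of all `u k` and D for the ring of integers. On the Fourier side, at one
scale and for one n, the new generators are a_{ℓ,r}(ϖξ) ψ̂_n(ξ), where the weight a_{ℓ,r}(ϖ·) is
Λ-periodic, and the translates by `u k` are modulations. The core fact is `inner_analysis_comm`: if
V is the bounded analysis operator of the Λ-modulations of one function g, then V*V commutes with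
multiplication by bounded Λ-periodic functions. Hence weights can be moved from one argument to the
other and collected: the mixed Gram sum over ℓ and k of systems r and r' is that of ψ_n with the
weight ∑_ℓ a_{ℓ,r} conj(a_{ℓ,r'}) = δ_{r,r'} (`exists_hasSum_gram`, `hasSum_innerL2_dilate`). For r
= r', summation over n and j returns the Parseval identity of the given frame, so each new system is
tight with constant 1. For r ≠ r' the analysis operators have orthogonal ranges, which is
orthogonality of the systems.

The commutation holds for b = χ(v·), v ∈ Λ, because this modulation merely permutes the index k. For
general b the defect is ∫ bH with H integrable and ∫ χ(v·)H = 0 for all v ∈ Λ. Since K = D ⊕ Λ and χ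
is trivial on products of elements of Λ, these integrals are the Fourier coefficients on D of the
Λ-periodization of H; so the periodization vanishes, and ∫ bH = 0
(`integral_mul_eq_zero_of_periodic`).

The Fourier transform on L² is the unitary operator sending the orthonormal basis vector
χ(z·)1_{v+D} to χ(-v·)1_{z+D}, for z, v ∈ Λ; `isFourierL2_iff` identifies it with the extension from
L¹ ∩ L². -/

set_option linter.unusedSectionVars false

noncomputable section

namespace LocalFieldWavelet

open MeasureTheory Filter Topology

namespace Setup

/-! ### Arithmetic of the lattice Λ and its pairing under χ -/

section Lattice

variable {K : Type*} [NontriviallyNormedField K] {t c : ℕ} [NeZero c] (W : Setup K t c)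

include W in
lemma ϖ_norm_pos : 0 < ‖W.ϖ‖ := by
  obtain ⟨x, hx, hx1⟩ := NormedField.exists_norm_lt_one K
  exact hx.trans_le (W.ϖ_max x hx1)

lemma ϖ_ne_zero : W.ϖ ≠ 0 := norm_pos_iff.1 W.ϖ_norm_pos

lemma one_lt_norm_inv_ϖ : 1 < ‖W.ϖ⁻¹‖ := by
  rw [norm_inv]
  exact (one_lt_inv₀ W.ϖ_norm_pos).2 W.ϖ_lt_one

lemma norm_ϖ_mul_le_one {x : K} (hx : ‖x‖ < 1) : ‖W.ϖ⁻¹ * x‖ ≤ 1 := by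
  rw [norm_mul, norm_inv, inv_mul_le_one₀ W.ϖ_norm_pos]
  exact W.ϖ_max x hx

lemma digit_zero : W.digit 0 = 0 := by simp [digit]

section

variable [Fact t.Prime]

include W in
lemma one_lt_card : 1 < t ^ c :=
  Nat.one_lt_pow (NeZero.ne c) (Fact.out : t.Prime).one_lt

lemma digit_eq (a : Fin c → Fin t) :
    W.digit (finFunctionFinEquiv a) = ∑ i, ((a i : ℕ) : K) * W.ζ i := by
  unfold digit
  refine Finset.sum_congr rfl fun i _ => ?_
  conv_rhs => rw [← finFunctionFinEquiv.symm_apply_apply a]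
  rfl

lemma exists_digit_eq (a : Fin c → Fin t) :
    ∃ b < t ^ c, W.digit b = ∑ i, ((a i : ℕ) : K) * W.ζ i :=
  ⟨_, (finFunctionFinEquiv a).2, W.digit_eq a⟩

lemma digit_eq_of_lt {b : ℕ} (hb : b < t ^ c) :
    W.digit b = ∑ i, ((finFunctionFinEquiv.symm (⟨b, hb⟩ : Fin (t ^ c)) i : ℕ) : K) * W.ζ i := by
  rw [← W.digit_eq, Equiv.apply_symm_apply]

lemma exists_digit_sub_lt {x : K} (hx : ‖x‖ ≤ 1) : ∃ b < t ^ c, ‖x - W.digit b‖ < 1 := by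
  obtain ⟨a, ha, -⟩ := W.residue x hx
  obtain ⟨b, hb, hab⟩ := W.exists_digit_eq a
  exact ⟨b, hb, by rwa [hab]⟩

/-- The subfield spanned by the `ζ i`. -/
def coeffField : Subfield K := W.span_subfield.choose

lemma mem_coeffField {x : K} : x ∈ W.coeffField ↔ ∃ b < t ^ c, W.digit b = x := by
  rw [← SetLike.mem_coe, coeffField, W.span_subfield.choose_spec]
  constructor
  · rintro ⟨a, rfl⟩
    exact W.exists_digit_eq a
  · rintro ⟨b, hb, rfl⟩
    exact ⟨_, (W.digit_eq_of_lt hb).symm⟩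

lemma digit_mem {b : ℕ} (hb : b < t ^ c) : W.digit b ∈ W.coeffField :=
  W.mem_coeffField.2 ⟨b, hb, rfl⟩

lemma u_eq_sum (n M : ℕ) (hM : n < M) :
    W.u n = ∑ j ∈ Finset.range M, W.digit (n / (t ^ c) ^ j % t ^ c) * W.ϖ⁻¹ * W.ϖ⁻¹ ^ j := by
  unfold u
  refine Finset.sum_subset (Finset.range_subset_range.2 hM) fun j _ hj => ?_
  have hj' : n < j := by simpa using hj
  have : n / (t ^ c) ^ j = 0 :=
    Nat.div_eq_of_lt (hj'.trans (Nat.lt_pow_self (one_lt_card W)))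
  rw [this, Nat.zero_mod, digit_zero, zero_mul, zero_mul]

lemma u_zero : W.u 0 = 0 := by simp [u, digit_zero]

/-- Splitting off the lowest base-q digit drives the strong inductions on n below. -/
lemma u_rec (n : ℕ) : W.u n = W.ϖ⁻¹ * (W.digit (n % t ^ c) + W.u (n / t ^ c)) := by
  have h1 := one_lt_card W
  rcases Nat.eq_zero_or_pos n with rfl | hn
  · simp [u_zero, digit_zero]
  rw [W.u_eq_sum (n / t ^ c) n (Nat.div_lt_self hn h1), u, Finset.sum_range_succ', mul_add,
    Finset.mul_sum, add_comm]
  congr 1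
  · simp [mul_comm]
  · refine Finset.sum_congr rfl fun j _ => ?_
    rw [Nat.div_div_eq_div_mul, ← pow_succ' (t ^ c) j]
    ring

lemma u_digit_add {b : ℕ} (hb : b < t ^ c) (k : ℕ) :
    W.u (b + t ^ c * k) = W.ϖ⁻¹ * (W.digit b + W.u k) := by
  rw [u_rec, Nat.add_mul_mod_self_left, Nat.mod_eq_of_lt hb,
    Nat.add_mul_div_left _ _ (by linarith [one_lt_card W]), Nat.div_eq_of_lt hb, zero_add]

/-- There are no carries: the digits range over a subfield, so addition is done digit by digit. -/
lemma exists_u_add (n m : ℕ) : ∃ k, W.u k = W.u n + W.u m := by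
  have h1 := one_lt_card W
  induction n using Nat.strong_induction_on generalizing m with
  | _ n ih =>
    rcases Nat.eq_zero_or_pos n with rfl | hn
    · exact ⟨m, by simp [u_zero]⟩
    obtain ⟨k, hk⟩ := ih (n / t ^ c) (Nat.div_lt_self hn h1) (m / t ^ c)
    obtain ⟨b, hb, hbe⟩ := W.mem_coeffField.1 (add_mem (W.digit_mem (Nat.mod_lt n (by omega)))
      (W.digit_mem (Nat.mod_lt m (by omega))))
    refine ⟨b + t ^ c * k, ?_⟩
    rw [u_digit_add W hb, hbe, hk, W.u_rec n, W.u_rec m]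
    ring

lemma exists_u_neg (n : ℕ) : ∃ k, W.u k = -W.u n := by
  have h1 := one_lt_card W
  induction n using Nat.strong_induction_on with
  | _ n ih =>
    rcases Nat.eq_zero_or_pos n with rfl | hn
    · exact ⟨0, by simp [u_zero]⟩
    obtain ⟨k, hk⟩ := ih (n / t ^ c) (Nat.div_lt_self hn h1)
    obtain ⟨b, hb, hbe⟩ := W.mem_coeffField.1 (neg_mem (W.digit_mem (Nat.mod_lt n (by omega))))
    refine ⟨b + t ^ c * k, ?_⟩
    rw [u_digit_add W hb, hbe, hk, W.u_rec n]
    ring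

/-- The set `{u(n)}` as an additive subgroup. -/
def lattice : AddSubgroup K where
  carrier := Set.range W.u
  zero_mem' := ⟨0, W.u_zero⟩
  add_mem' := by
    rintro _ _ ⟨n, rfl⟩ ⟨m, rfl⟩
    exact W.exists_u_add n m
  neg_mem' := by
    rintro _ ⟨n, rfl⟩
    exact W.exists_u_neg n

lemma u_mem (n : ℕ) : W.u n ∈ W.lattice := ⟨n, rfl⟩

lemma mem_lattice {x : K} : x ∈ W.lattice ↔ ∃ n, W.u n = x := Iff.rfl

instance : Countable W.lattice := (Set.countable_range W.u).to_subtype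

/-- Since ζ₀ = 1, this value is the primitive t-th root of unity, and t > 1. -/
lemma χ_inv_ϖ : W.χ (W.ϖ⁻¹) ≠ 1 := by
  intro h
  have h1 := W.χ_value 0 1
  have ht := (Fact.out : t.Prime).one_lt
  simp only [W.ζ_zero, one_mul, zpow_neg, zpow_one, h] at h1
  have h2 := (Complex.isPrimitiveRoot_exp t (by omega)).pow_eq_one_iff_dvd 1
  simp only [and_self, if_true] at h1
  rw [pow_one, ← h1] at h2
  have := Nat.dvd_one.1 (h2.1 (by simp))
  omega

lemma exists_χ_ne_one {z : K} (hz : 1 < ‖z‖) : ∃ y, ‖y‖ ≤ 1 ∧ W.χ (z * y) ≠ 1 := by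
  have hz0 : z ≠ 0 := norm_pos_iff.1 (one_pos.trans hz)
  refine ⟨W.ϖ⁻¹ * z⁻¹, W.norm_ϖ_mul_le_one ?_, ?_⟩
  · rw [norm_inv]
    exact inv_lt_one_of_one_lt₀ hz
  · rw [mul_comm W.ϖ⁻¹, mul_inv_cancel_left₀ hz0]
    exact W.χ_inv_ϖ

/-- χ detects only the coefficient of ζ₀ϖ⁻¹, and the exponent here is at least 2. -/
lemma χ_digit_mul {f : K} (hf : f ∈ W.coeffField) {j : ℕ} (hj : 2 ≤ j) :
    W.χ (f * W.ϖ⁻¹ ^ j) = 1 := by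
  obtain ⟨b, hb, rfl⟩ := W.mem_coeffField.1 hf
  rw [digit, Finset.sum_mul]
  suffices h : ∀ s : Finset (Fin c), W.χ (∑ i ∈ s, ((b / t ^ (i : ℕ) % t : ℕ) : K) * W.ζ i *
      W.ϖ⁻¹ ^ j) = 1 from h _
  intro s
  induction s using Finset.cons_induction with
  | empty => simp
  | cons i s hi ih =>
  rw [Finset.sum_cons, AddChar.map_add_eq_mul, ih, mul_one]
  rw [mul_assoc, ← nsmul_eq_mul, AddChar.map_nsmul_eq_pow]
  have h := W.χ_value i j
  rw [if_neg (by rintro ⟨-, h⟩; norm_cast at h; omega), zpow_neg, zpow_natCast, ← inv_pow] at h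
  rw [Circle.ext h (y := 1), one_pow]

/-- Every term of `u n` already carries a factor ϖ⁻¹, and products of digits stay in the coefficient
field, so only powers of ϖ⁻¹ with exponent at least 2 occur. -/
lemma χ_digit_mul_u {f : K} (hf : f ∈ W.coeffField) {j : ℕ} (hj : 1 ≤ j) (n : ℕ) :
    W.χ (f * W.ϖ⁻¹ ^ j * W.u n) = 1 := by
  have h1 := one_lt_card W
  induction n using Nat.strong_induction_on generalizing j with
  | _ n ih =>
    rcases Nat.eq_zero_or_pos n with rfl | hn
    · simp [u_zero]
    have : f * W.ϖ⁻¹ ^ j * W.u n = (f * W.digit (n % t ^ c)) * W.ϖ⁻¹ ^ (j + 1) +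
        f * W.ϖ⁻¹ ^ (j + 1) * W.u (n / t ^ c) := by
      rw [W.u_rec n]; ring
    rw [this, AddChar.map_add_eq_mul, ih _ (Nat.div_lt_self hn h1) (by omega),
      W.χ_digit_mul (mul_mem hf (W.digit_mem (Nat.mod_lt n (by omega)))) (by omega), one_mul]

lemma χ_u_mul_u_aux (k n j : ℕ) : W.χ (W.ϖ⁻¹ ^ j * W.u k * W.u n) = 1 := by
  have h1 := one_lt_card W
  induction k using Nat.strong_induction_on generalizing j with
  | _ k ih =>
    rcases Nat.eq_zero_or_pos k with rfl | hk
    · simp [u_zero]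
    have : W.ϖ⁻¹ ^ j * W.u k * W.u n = W.digit (k % t ^ c) * W.ϖ⁻¹ ^ (j + 1) * W.u n +
        W.ϖ⁻¹ ^ (j + 1) * W.u (k / t ^ c) * W.u n := by
      rw [W.u_rec k]; ring
    rw [this, AddChar.map_add_eq_mul, ih _ (Nat.div_lt_self hk h1),
      W.χ_digit_mul_u (W.digit_mem (Nat.mod_lt k (by omega))) (by omega), one_mul]

/-- Λ annihilates itself, so the characters with frequency in Λ are Λ-periodic. -/
lemma χ_mul_mem {x y : K} (hx : x ∈ W.lattice) (hy : y ∈ W.lattice) : W.χ (x * y) = 1 := by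
  obtain ⟨k, rfl⟩ := hx
  obtain ⟨n, rfl⟩ := hy
  simpa using W.χ_u_mul_u_aux k n 0

variable [IsUltrametricDist K]

omit [NeZero c] [Fact t.Prime] in
lemma norm_sub_le_max_norm (x y : K) : ‖x - y‖ ≤ max ‖x‖ ‖y‖ := by
  simpa [sub_eq_add_neg] using IsUltrametricDist.norm_add_le_max x (-y)

lemma norm_digit_le (b : ℕ) : ‖W.digit b‖ ≤ 1 := by
  refine IsUltrametricDist.norm_sum_le_of_forall_le_of_nonneg zero_le_one fun i _ => ?_
  rw [norm_mul, W.ζ_norm, mul_one]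
  exact IsUltrametricDist.norm_natCast_le_one K _

lemma eq_of_digit_norm_sub_lt {a b : ℕ} (ha : a < t ^ c) (hb : b < t ^ c)
    (h : ‖W.digit a - W.digit b‖ < 1) : a = b := by
  have h' := W.residue (W.digit a) (W.norm_digit_le a)
  have := h'.unique (y₁ := finFunctionFinEquiv.symm ⟨a, ha⟩)
    (y₂ := finFunctionFinEquiv.symm ⟨b, hb⟩) ?_ ?_
  · simpa using this
  · rw [← W.digit_eq_of_lt ha]; simp
  · rwa [← W.digit_eq_of_lt hb]

/-- By the ultrametric inequality a nonzero higher part, of norm above 1, dominates the lowest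
digit, of norm at most 1. Hence Λ meets D only in 0. -/
lemma one_lt_norm_u {n : ℕ} (hn : n ≠ 0) : 1 < ‖W.u n‖ := by
  have h1 := one_lt_card W
  induction n using Nat.strong_induction_on with
  | _ n ih =>
    rw [u_rec, norm_mul]
    have hq := W.one_lt_norm_inv_ϖ
    rcases eq_or_ne (n / t ^ c) 0 with h0 | h0
    · rw [h0, u_zero, add_zero]
      have hlt : n < t ^ c := by
        rcases Nat.div_eq_zero_iff.1 h0 with h | h
        · omega
        · exact h
      rw [Nat.mod_eq_of_lt hlt]
      have hd : 1 ≤ ‖W.digit n‖ := by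
        by_contra! h
        exact hn (W.eq_of_digit_norm_sub_lt hlt (by omega : 0 < t ^ c) (by simpa [digit_zero]))
      nlinarith
    · have h2 := ih _ (Nat.div_lt_self (Nat.pos_of_ne_zero hn) h1) h0
      have h3 := W.norm_digit_le (n % t ^ c)
      rw [IsUltrametricDist.norm_add_eq_max_of_norm_ne_norm (by linarith), max_eq_right (by linarith)]
      nlinarith

lemma eq_zero_of_mem_lattice {x : K} (hx : x ∈ W.lattice) (h : ‖x‖ ≤ 1) : x = 0 := by
  obtain ⟨n, rfl⟩ := hx
  rcases eq_or_ne n 0 with rfl | hn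
  · exact W.u_zero
  · exact absurd (W.one_lt_norm_u hn) h.not_gt

lemma u_injective : Function.Injective W.u := by
  intro n m h
  have h1 := one_lt_card W
  induction n using Nat.strong_induction_on generalizing m with
  | _ n ih =>
    rcases eq_or_ne n 0 with rfl | hn
    · by_contra hm
      have := W.one_lt_norm_u (Ne.symm hm)
      rw [← h, u_zero, norm_zero] at this
      linarith
    rw [W.u_rec n, W.u_rec m] at h
    have h2 := mul_left_cancel₀ (inv_ne_zero W.ϖ_ne_zero) h
    -- One side is integral and the other lies in Λ, so both vanish.
    have h3 : W.digit (n % t ^ c) - W.digit (m % t ^ c) = W.u (m / t ^ c) - W.u (n / t ^ c) := by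
      linear_combination h2
    have h4 : W.u (m / t ^ c) - W.u (n / t ^ c) = 0 := by
      refine W.eq_zero_of_mem_lattice (sub_mem (W.u_mem _) (W.u_mem _)) ?_
      rw [← h3]
      exact (norm_sub_le_max_norm _ _).trans
        (max_le (W.norm_digit_le _) (W.norm_digit_le _))
    have h5 : n % t ^ c = m % t ^ c :=
      W.eq_of_digit_norm_sub_lt (Nat.mod_lt n (by omega)) (Nat.mod_lt m (by omega))
        (by rw [h3, h4]; simp)
    have h6 := ih _ (Nat.div_lt_self (Nat.pos_of_ne_zero hn) h1) (sub_eq_zero.1 h4).symm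
    rw [← Nat.mod_add_div n (t ^ c), ← Nat.mod_add_div m (t ^ c), h5, h6]

/-- Induction on m with ‖x‖ ≤ ‖ϖ⁻¹‖^m: approximate ϖx, correct the integral error by a residue digit
to norm below 1, and rescale. With `eq_zero_of_mem_lattice` this gives K = D ⊕ Λ. -/
lemma exists_norm_sub_u_le (x : K) : ∃ n, ‖x - W.u n‖ ≤ 1 := by
  obtain ⟨m, hm⟩ := pow_unbounded_of_one_lt ‖x‖ W.one_lt_norm_inv_ϖ
  replace hm := hm.le
  induction m generalizing x with
  | zero => exact ⟨0, by simpa [u_zero] using hm⟩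
  | succ m ih =>
    obtain ⟨k, hk⟩ := ih (W.ϖ * x) (by
      rw [norm_mul]
      calc ‖W.ϖ‖ * ‖x‖ ≤ ‖W.ϖ‖ * ‖W.ϖ⁻¹‖ ^ (m + 1) := by gcongr
        _ = ‖W.ϖ⁻¹‖ ^ m := by
          rw [norm_inv, pow_succ', mul_inv_cancel_left₀ W.ϖ_norm_pos.ne'])
    obtain ⟨b, hb, hbk⟩ := W.exists_digit_sub_lt hk
    refine ⟨b + t ^ c * k, ?_⟩
    rw [u_digit_add W hb]
    have := W.norm_ϖ_mul_le_one hbk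
    have h0 := W.ϖ_ne_zero
    convert this using 2
    field_simp
    ring

lemma exists_mem_lattice (x : K) : ∃ v ∈ W.lattice, ‖x - v‖ ≤ 1 := by
  obtain ⟨n, hn⟩ := W.exists_norm_sub_u_le x
  exact ⟨_, W.u_mem n, hn⟩

lemma eq_of_norm_sub_le {x v v' : K} (hv : v ∈ W.lattice) (hv' : v' ∈ W.lattice)
    (h : ‖x - v‖ ≤ 1) (h' : ‖x - v'‖ ≤ 1) : v = v' := by
  rw [← sub_eq_zero]
  refine W.eq_zero_of_mem_lattice (sub_mem hv hv') ?_
  have : v - v' = (x - v') - (x - v) := by ring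
  rw [this]
  exact (norm_sub_le_max_norm _ _).trans (max_le h' h)

/-- The lattice characters separate the points of the ring of integers. -/
lemma exists_lattice_χ_ne_one {z : K} (hz : z ≠ 0) (hz1 : ‖z‖ ≤ 1) :
    ∃ v ∈ W.lattice, W.χ (v * z) ≠ 1 := by
  -- With this v the product vz differs from ϖ⁻¹ by an integer of K, so χ(vz) = χ(ϖ⁻¹) ≠ 1.
  obtain ⟨v, hv, h⟩ := W.exists_mem_lattice (W.ϖ⁻¹ * z⁻¹)
  refine ⟨v, hv, fun h1 => W.χ_inv_ϖ ?_⟩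
  have : W.ϖ⁻¹ = (W.ϖ⁻¹ * z⁻¹ - v) * z + v * z := by field_simp; ring
  rw [this, AddChar.map_add_eq_mul, h1, mul_one, W.χ_integers]
  rw [norm_mul]
  exact mul_le_one₀ h (norm_nonneg _) hz1

end

end Lattice

end Setup

/-! ### Fourier uniqueness on D and periodization -/

/-- An integrable function on a compact metric space that is orthogonal to a dense space of
continuous functions vanishes almost everywhere. -/
lemma ae_eq_zero_of_forall_integral_mul_eq_zero {X : Type*} [MetricSpace X] [CompactSpace X]
    [MeasurableSpace X] [BorelSpace X] {ν : Measure X} [IsFiniteMeasure ν] {P : X → ℂ}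
    (hP : Integrable P ν) (S : Submodule ℂ C(X, ℂ)) (hS : S.topologicalClosure = ⊤)
    (h : ∀ g ∈ S, ∫ x, g x * P x ∂ν = 0) : P =ᵐ[ν] 0 := by
  have hint : ∀ g : C(X, ℂ), Integrable (fun x => g x * P x) ν := fun g =>
    hP.bdd_mul g.continuous.aestronglyMeasurable (ae_of_all _ g.norm_coe_le_norm)
  let T : C(X, ℂ) →ₗ[ℂ] ℂ :=
    { toFun := fun g => ∫ x, g x * P x ∂ν
      map_add' := fun g g' => by
        rw [← integral_add (hint g) (hint g')]
        simp [add_mul]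
      map_smul' := fun a g => by
        simp [mul_assoc, integral_const_mul] }
  have hT : Continuous T := by
    refine (T.mkContinuous (∫ x, ‖P x‖ ∂ν) fun g => ?_).continuous
    refine (norm_integral_le_of_norm_le (hP.norm.const_mul ‖g‖) (ae_of_all _ fun x => ?_)).trans_eq
      (by rw [integral_const_mul, mul_comm])
    rw [norm_mul]
    gcongr
    exact g.norm_coe_le_norm x
  have key : ∀ g : C(X, ℂ), ∫ x, g x * P x ∂ν = 0 := by
    intro g
    have hg : g ∈ S.topologicalClosure := by rw [hS]; trivial
    have : closure (S : Set C(X, ℂ)) ⊆ {g | T g = 0} :=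
      closure_minimal (fun g hg => h g hg) (isClosed_eq hT continuous_const)
    exact this hg
  -- Indicators of closed sets are bounded pointwise limits of continuous thickened indicators, so
  -- dominated convergence applies.
  refine ae_eq_zero_of_forall_setIntegral_isClosed_eq_zero hP fun s hs => ?_
  have hδ : ∀ n : ℕ, 0 < 1 / ((n : ℝ) + 1) := fun n => by positivity
  have hlim := thickenedIndicator_tendsto_indicator_closure hδ
    tendsto_one_div_add_atTop_nhds_zero_nat s
  rw [tendsto_pi_nhds, hs.closure_eq] at hlim
  have hcont : ∀ n, Continuous fun x => ((thickenedIndicator (hδ n) s x : ℝ) : ℂ) := fun n => by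
    fun_prop
  have h1 : Tendsto (fun n : ℕ => ∫ x, ((thickenedIndicator (hδ n) s x : ℝ) : ℂ) * P x ∂ν) atTop
      (𝓝 (∫ x in s, P x ∂ν)) := by
    rw [← integral_indicator hs.measurableSet]
    refine tendsto_integral_of_dominated_convergence (fun x => ‖P x‖)
      (fun n => (hint ⟨_, hcont n⟩).aestronglyMeasurable) hP.norm
      (fun n => ae_of_all _ fun x => ?_) (ae_of_all _ fun x => ?_)
    · rw [norm_mul]
      refine mul_le_of_le_one_left (norm_nonneg _) ?_
      simpa using thickenedIndicator_le_one (hδ n) s x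
    · have h2 : s.indicator P x = (((s.indicator (fun _ => (1 : NNReal)) x : NNReal) : ℝ) : ℂ) * P x := by
        by_cases hx : x ∈ s <;> simp [hx]
      rw [h2]
      refine Tendsto.mul_const _ ?_
      exact (Complex.continuous_ofReal.tendsto _).comp ((NNReal.continuous_coe.tendsto _).comp (hlim x))
  refine tendsto_nhds_unique h1 ?_
  have h3 : ∀ n : ℕ, ∫ x, ((thickenedIndicator (hδ n) s x : ℝ) : ℂ) * P x ∂ν = 0 :=
    fun n => key ⟨_, hcont n⟩
  simp only [h3]
  exact tendsto_const_nhds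

namespace Setup

variable {K : Type*} [NontriviallyNormedField K] {t c : ℕ} [NeZero c] (W : Setup K t c)

/-- The character `x ↦ χ(z x)` with values in `ℂ`. -/
def e (z x : K) : ℂ := (W.χ (z * x) : ℂ)

@[simp] lemma norm_e (z x : K) : ‖W.e z x‖ = 1 := Circle.norm_coe _

lemma continuous_e (z : K) : Continuous (W.e z) := by
  have := W.χ_continuous.comp (continuous_const_mul z)
  unfold e
  fun_prop

lemma e_comm (z x : K) : W.e z x = W.e x z := by rw [e, e, mul_comm]

lemma e_add_right (z x y : K) : W.e z (x + y) = W.e z x * W.e z y := by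
  simp [e, mul_add, AddChar.map_add_eq_mul]

lemma e_add_left (z w x : K) : W.e (z + w) x = W.e z x * W.e w x := by
  simp [e, add_mul, AddChar.map_add_eq_mul]

@[simp] lemma e_zero_left (x : K) : W.e 0 x = 1 := by simp [e]

@[simp] lemma e_zero_right (x : K) : W.e x 0 = 1 := by simp [e]

lemma conj_e (z x : K) : starRingEnd ℂ (W.e z x) = W.e (-z) x := by
  rw [e, e, neg_mul, AddChar.map_neg_eq_inv, Circle.coe_inv_eq_conj]

lemma e_neg_right (z x : K) : W.e z (-x) = W.e (-z) x := by simp [e]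

lemma e_eq_one {z x : K} (h : ‖z * x‖ ≤ 1) : W.e z x = 1 := by
  rw [e, W.χ_integers _ h, Circle.coe_one]

lemma e_mul_assoc (z a x : K) : W.e z (a * x) = W.e (z * a) x := by rw [e, e, mul_assoc]

section

variable [Fact t.Prime]

lemma e_lattice {z x : K} (hz : z ∈ W.lattice) (hx : x ∈ W.lattice) : W.e z x = 1 := by
  rw [e, W.χ_mul_mem hz hx, Circle.coe_one]

lemma e_add_lattice {z v : K} (hz : z ∈ W.lattice) (hv : v ∈ W.lattice) (x : K) :
    W.e z (x + v) = W.e z x := by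
  rw [e_add_right, W.e_lattice hz hv, mul_one]

variable [ProperSpace K] [MeasurableSpace K] [BorelSpace K] (μ : Measure K)

lemma integrable_e_mul (z : K) {f : K → ℂ} {ν : Measure K} (hf : Integrable f ν) :
    Integrable (fun x => W.e z x * f x) ν :=
  hf.bdd_mul (c := 1) (W.continuous_e z).aestronglyMeasurable (ae_of_all _ fun x => by simp)

variable [μ.IsAddHaarMeasure]

omit [ProperSpace K] [Fact t.Prime] in
lemma setIntegral_closedBall_add (v : K) (r : ℝ) (f : K → ℂ) :
    ∫ x in Metric.closedBall v r, f x ∂μ = ∫ x in Metric.closedBall 0 r, f (x + v) ∂μ := by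
  rw [← integral_indicator Metric.isClosed_closedBall.measurableSet,
    ← integral_indicator Metric.isClosed_closedBall.measurableSet,
    ← integral_add_right_eq_self _ v]
  congr 1
  ext x
  have : x + v ∈ Metric.closedBall v r ↔ x ∈ Metric.closedBall (0 : K) r := by
    simp [dist_eq_norm]
  by_cases hx : x ∈ Metric.closedBall (0 : K) r
  · rw [Set.indicator_of_mem hx, Set.indicator_of_mem (this.2 hx)]
  · rw [Set.indicator_of_notMem hx, Set.indicator_of_notMem (this.not.2 hx)]

variable [IsUltrametricDist K]

/-- If z is not integral, translating D by a y ∈ D with χ(zy) ≠ 1 multiplies the integral by χ(zy)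
and leaves it unchanged, so it is zero. -/
lemma integral_e (hμ : μ (Metric.closedBall 0 1) = 1) (z : K) :
    ∫ x in Metric.closedBall 0 1, W.e z x ∂μ = if ‖z‖ ≤ 1 then 1 else 0 := by
  split_ifs with hz
  · have : ∀ x ∈ Metric.closedBall (0 : K) 1, W.e z x = 1 := fun x hx => by
      refine W.e_eq_one ?_
      rw [norm_mul]
      exact mul_le_one₀ hz (norm_nonneg _) (by simpa using hx)
    rw [setIntegral_congr_fun Metric.isClosed_closedBall.measurableSet this]
    simp [measureReal_def, hμ]
  · obtain ⟨y, hy, hy1⟩ := W.exists_χ_ne_one (not_le.1 hz)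
    have h1 := setIntegral_closedBall_add μ y 1 (W.e z)
    have h2 : Metric.closedBall y 1 = Metric.closedBall (0 : K) 1 :=
      IsUltrametricDist.closedBall_eq_of_mem (by simpa using hy)
    simp only [e_add_right] at h1
    rw [h2, integral_mul_const] at h1
    have h3 : W.e z y ≠ 1 := fun h => hy1 (Circle.ext h)
    have h4 : (∫ x in Metric.closedBall 0 1, W.e z x ∂μ) * (W.e z y - 1) = 0 := by
      linear_combination -h1
    exact (mul_eq_zero.1 h4).resolve_right (sub_ne_zero.2 h3)

/-- The restriction of a character to the ring of integers. -/
def eInt (z : K) : C(Metric.closedBall (0 : K) 1, ℂ) :=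
  ⟨fun x => W.e z x, (W.continuous_e z).comp continuous_subtype_val⟩

/-- Stone–Weierstrass: the characters from Λ are closed under products and conjugation, so their
span is a star subalgebra, and they separate points of D. -/
lemma span_eInt_dense :
    (Submodule.span ℂ (Set.range fun v : W.lattice => W.eInt v)).topologicalClosure = ⊤ := by
  let A : StarSubalgebra ℂ C(Metric.closedBall (0 : K) 1, ℂ) :=
    { toSubalgebra := Algebra.adjoin ℂ (Set.range fun v : W.lattice => W.eInt v)
      star_mem' := by
        change Algebra.adjoin ℂ (Set.range fun v : W.lattice => W.eInt v) ≤
          star (Algebra.adjoin ℂ (Set.range fun v : W.lattice => W.eInt v))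
        refine Algebra.adjoin_le ?_
        rintro - ⟨v, rfl⟩
        exact Algebra.subset_adjoin ⟨-v, ContinuousMap.ext fun x => (W.conj_e _ _).symm⟩ }
  have hA : Subalgebra.toSubmodule A.toSubalgebra =
      Submodule.span ℂ (Set.range fun v : W.lattice => W.eInt v) := by
    apply Algebra.adjoin_eq_span_of_subset
    refine Set.Subset.trans ?_ Submodule.subset_span
    intro x hx
    refine Submonoid.closure_induction (fun _ => id) ⟨0, ?_⟩ ?_ hx
    · ext1 x
      exact W.e_zero_left x
    · rintro - - - - ⟨v, rfl⟩ ⟨w, rfl⟩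
      exact ⟨v + w, ContinuousMap.ext fun x => W.e_add_left _ _ _⟩
  have hsep : A.SeparatesPoints := by
    intro x y hxy
    have h1 : (x : K) - y ≠ 0 := sub_ne_zero.2 (Subtype.coe_injective.ne hxy)
    have hx : ‖(x : K)‖ ≤ 1 := mem_closedBall_zero_iff.1 x.2
    have hy : ‖(y : K)‖ ≤ 1 := mem_closedBall_zero_iff.1 y.2
    obtain ⟨v, hv, hne⟩ := W.exists_lattice_χ_ne_one h1
      ((norm_sub_le_max_norm _ _).trans (max_le hx hy))
    refine ⟨_, ⟨W.eInt v, Algebra.subset_adjoin ⟨⟨v, hv⟩, rfl⟩, rfl⟩, fun h => hne ?_⟩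
    have h' : W.e v (x : K) = W.e v y := h
    refine Circle.ext ?_
    change W.e v (x - y) = 1
    rw [sub_eq_add_neg, e_add_right, h', ← e_add_right, add_neg_cancel, e_zero_right]
  rw [← hA]
  exact congr_arg (Subalgebra.toSubmodule <| StarSubalgebra.toSubalgebra ·)
    (ContinuousMap.starSubalgebra_topologicalClosure_eq_top_of_separatesPoints A hsep)

omit [μ.IsAddHaarMeasure] in
/-- Uniqueness of Fourier coefficients on the ring of integers. -/
lemma ae_eq_zero_of_coeff_eq_zero [IsFiniteMeasureOnCompacts μ] {P : K → ℂ}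
    (hP : IntegrableOn P (Metric.closedBall 0 1) μ)
    (h : ∀ v ∈ W.lattice, ∫ x in Metric.closedBall 0 1, W.e v x * P x ∂μ = 0) :
    ∀ᵐ x ∂(μ.restrict (Metric.closedBall 0 1)), P x = 0 := by
  have hD : MeasurableSet (Metric.closedBall (0 : K) 1) := Metric.isClosed_closedBall.measurableSet
  have hfin : IsFiniteMeasure (μ.comap (Subtype.val : Metric.closedBall (0 : K) 1 → K)) := by
    refine ⟨?_⟩
    rw [(MeasurableEmbedding.subtype_coe hD).comap_apply]
    refine (measure_mono (t := Metric.closedBall (0 : K) 1)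
      (by rintro _ ⟨x, -, rfl⟩; exact x.2)).trans_lt ?_
    exact (isCompact_closedBall _ _).measure_lt_top
  have hcompact : CompactSpace (Metric.closedBall (0 : K) 1) :=
    isCompact_iff_compactSpace.1 (isCompact_closedBall _ _)
  have hP' : Integrable (P ∘ (Subtype.val : Metric.closedBall (0 : K) 1 → K))
      (μ.comap Subtype.val) := (integrableOn_iff_comap_subtypeVal hD).1 hP
  have key := ae_eq_zero_of_forall_integral_mul_eq_zero hP' _ W.span_eInt_dense ?_
  · have h2 := (ae_restrict_iff_subtype hD (p := fun x => P x = 0) (μ := μ)).2 ?_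
    · exact h2
    · exact key
  · intro g hg
    induction hg using Submodule.span_induction with
    | mem g hg =>
      obtain ⟨v, rfl⟩ := hg
      have := h v v.2
      rw [← integral_subtype_comap hD] at this
      exact this
    | zero => simp
    | add g g' _ _ hg hg' =>
      have hint : ∀ g : C(Metric.closedBall (0 : K) 1, ℂ),
          Integrable (fun x => g x * (P ∘ (Subtype.val : Metric.closedBall (0 : K) 1 → K)) x)
            (μ.comap Subtype.val) := fun g =>
        hP'.bdd_mul g.continuous.aestronglyMeasurable (ae_of_all _ g.norm_coe_le_norm)
      simp only [ContinuousMap.add_apply, add_mul]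
      rw [integral_add (hint g) (hint g'), hg, hg', add_zero]
    | smul a g _ hg =>
      simp only [ContinuousMap.smul_apply, smul_eq_mul, mul_assoc]
      rw [integral_const_mul, hg, mul_zero]

/-- Uniqueness of Fourier coefficients on all translates of the ring of integers. -/
lemma ae_eq_zero_of_forall_coeff_eq_zero {P : K → ℂ}
    (hP : ∀ v ∈ W.lattice, IntegrableOn P (Metric.closedBall v 1) μ)
    (h : ∀ w ∈ W.lattice, ∀ v ∈ W.lattice, ∫ x in Metric.closedBall v 1, W.e w x * P x ∂μ = 0) :
    P =ᵐ[μ] 0 := by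
  have key : ∀ v : W.lattice, ∀ᵐ x ∂μ, x ∈ Metric.closedBall (v : K) 1 → P x = 0 := by
    intro v
    have h1 : IntegrableOn (fun x => P (x + v)) (Metric.closedBall 0 1) μ := by
      have h2 := (measurePreserving_add_right μ (v : K)).integrableOn_comp_preimage
        (measurableEmbedding_addRight (v : K)) (f := P) (s := Metric.closedBall (v : K) 1)
      have h3 : (fun x => x + (v : K)) ⁻¹' Metric.closedBall (v : K) 1 = Metric.closedBall 0 1 := by
        ext x; simp [dist_eq_norm]
      rw [h3] at h2
      exact h2.2 (hP v v.2)
    have h4 := W.ae_eq_zero_of_coeff_eq_zero μ h1 fun w hw => by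
      rw [← h w hw v v.2, setIntegral_closedBall_add μ (v : K) 1 fun x => W.e w x * P x]
      congr 1
      ext x
      rw [W.e_add_lattice hw v.2]
    rw [ae_restrict_iff' Metric.isClosed_closedBall.measurableSet] at h4
    have h5 := (measurePreserving_add_right μ (-(v : K))).quasiMeasurePreserving.ae h4
    filter_upwards [h5] with x hx hxv
    simpa using hx (by simpa [dist_eq_norm, sub_eq_add_neg] using hxv)
  filter_upwards [ae_all_iff.2 key] with x hx
  obtain ⟨v, hv, hxv⟩ := W.exists_mem_lattice x
  exact hx ⟨v, hv⟩ (by simpa [dist_eq_norm] using hxv)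

lemma iUnion_closedBall_lattice : ⋃ v : W.lattice, Metric.closedBall (v : K) 1 = Set.univ := by
  refine Set.eq_univ_of_forall fun x => ?_
  obtain ⟨v, hv, hxv⟩ := W.exists_mem_lattice x
  exact Set.mem_iUnion.2 ⟨⟨v, hv⟩, by simpa [dist_eq_norm] using hxv⟩

lemma pairwise_disjoint_closedBall_lattice :
    Pairwise (Function.onFun Disjoint fun v : W.lattice => Metric.closedBall (v : K) 1) := by
  intro v w hvw
  refine Set.disjoint_left.2 fun x hx hx' => hvw (Subtype.ext ?_)
  exact W.eq_of_norm_sub_le v.2 w.2 (by simpa [dist_eq_norm] using hx)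
    (by simpa [dist_eq_norm] using hx')

/-- `K` is the product of the ring of integers and the lattice. -/
lemma measurePreserving_add_lattice :
    MeasurePreserving (fun p : K × W.lattice => p.1 + p.2)
      ((μ.restrict (Metric.closedBall 0 1)).prod Measure.count) μ := by
  have hm : Measurable fun p : K × W.lattice => p.1 + (p.2 : K) :=
    measurable_fst.add (measurable_subtype_coe.comp measurable_snd)
  refine ⟨hm, Measure.ext fun s hs => ?_⟩
  rw [Measure.map_apply hm hs, Measure.prod_apply_symm (hm hs), lintegral_count]
  conv_rhs => rw [← Set.inter_univ s, ← W.iUnion_closedBall_lattice, Set.inter_iUnion]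
  rw [measure_iUnion]
  · refine tsum_congr fun v => ?_
    rw [Measure.restrict_apply (measurable_prodMk_right (hm hs)),
      ← (measurePreserving_add_right μ (v : K)).measure_preimage
        (hs.inter Metric.isClosed_closedBall.measurableSet).nullMeasurableSet]
    congr 1
    ext x
    simp [dist_eq_norm]
  · exact fun v w hvw => (W.pairwise_disjoint_closedBall_lattice hvw).mono
      Set.inter_subset_right Set.inter_subset_right
  · exact fun v => hs.inter Metric.isClosed_closedBall.measurableSet

/-- An integrable function whose periodization has vanishing Fourier coefficients is orthogonal to
all bounded periodic functions. -/
lemma integral_mul_eq_zero_of_periodic {H b : K → ℂ} (hH : Integrable H μ)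
    (h : ∀ v ∈ W.lattice, ∫ x, W.e v x * H x ∂μ = 0)
    (hb : AEStronglyMeasurable b μ) {C : ℝ} (hC : ∀ᵐ x ∂μ, ‖b x‖ ≤ C)
    (hper : ∀ v ∈ W.lattice, ∀ᵐ x ∂μ, b (x + v) = b x) :
    ∫ x, b x * H x ∂μ = 0 := by
  have hmp := W.measurePreserving_add_lattice μ
  have hint := (hmp.integrable_comp hH.aestronglyMeasurable).2 hH
  -- Unfolding over D × Λ is needed both for b, bounded by C, and for the characters, bounded by 1;
  -- hence the bound `C ⊔ 1`.
  have unfold_integral : ∀ w : K → ℂ, AEStronglyMeasurable w μ → (∀ᵐ x ∂μ, ‖w x‖ ≤ C ⊔ 1) →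
      (∀ v ∈ W.lattice, ∀ᵐ x ∂μ, w (x + v) = w x) →
      ∫ x, w x * H x ∂μ = ∫ x in Metric.closedBall 0 1,
        w x * ∫ v : W.lattice, H (x + v) ∂Measure.count ∂μ := by
    intro w hw hwC hwp
    have hwH : Integrable (fun x => w x * H x) μ := hH.bdd_mul hw hwC
    have h1 := (hmp.integrable_comp hwH.aestronglyMeasurable).2 hwH
    have h2 : ∫ x, w x * H x ∂μ = ∫ p : K × W.lattice, w (p.1 + p.2) * H (p.1 + p.2)
        ∂((μ.restrict (Metric.closedBall 0 1)).prod Measure.count) := by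
      conv_lhs => rw [← hmp.map_eq]
      rw [integral_map hmp.measurable.aemeasurable (by rw [hmp.map_eq]; exact hwH.1)]
    refine h2.trans ((integral_prod _ h1).trans ?_)
    refine integral_congr_ae (ae_restrict_of_ae ?_)
    filter_upwards [ae_all_iff.2 fun v : W.lattice => hwp v v.2] with x hx
    rw [← integral_const_mul]
    refine integral_congr_ae (ae_of_all _ fun v => ?_)
    change w (x + v) * H (x + v) = _
    rw [hx]
  have hP := W.ae_eq_zero_of_coeff_eq_zero μ hint.integral_prod_left fun v hv => by
    rw [← h v hv]
    exact (unfold_integral (W.e v) (W.continuous_e v).aestronglyMeasurable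
      (ae_of_all _ fun x => by simp)
      fun w hw => ae_of_all _ fun x => W.e_add_lattice hv hw x).symm
  rw [unfold_integral b hb (hC.mono fun x hx => hx.trans le_sup_left) hper]
  refine integral_eq_zero_of_ae ?_
  filter_upwards [hP] with x hx
  change b x * _ = 0
  exact mul_eq_zero_of_right _ hx

end

end Setup

/-! ### The Fourier transform on L²(K) -/

lemma innerL2_eq_inner {X : Type*} [MeasurableSpace X] {μ : Measure X} {f g : X → ℂ}
    (hf : MemLp f 2 μ) (hg : MemLp g 2 μ) :
    innerL2 μ f g = inner ℂ (hg.toLp g) (hf.toLp f) := by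
  rw [L2.inner_def, innerL2]
  refine integral_congr_ae ?_
  filter_upwards [hf.coeFn_toLp, hg.coeFn_toLp] with x hx hx'
  rw [hx, hx', RCLike.inner_apply]

lemma tendsto_toLp_iff {X ι : Type*} [MeasurableSpace X] {μ : Measure X} {l : Filter ι}
    {s : ι → X → ℂ} {f : X → ℂ} (hs : ∀ n, MemLp (s n) 2 μ) (hf : MemLp f 2 μ) :
    Tendsto (fun n => (hs n).toLp (s n)) l (𝓝 (hf.toLp f)) ↔
      Tendsto (fun n => eLpNorm (s n - f) 2 μ) l (𝓝 0) :=
  Lp.tendsto_Lp_iff_tendsto_eLpNorm'' s hs f hf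

namespace Setup

variable {K : Type*} [NontriviallyNormedField K] {t c : ℕ} [NeZero c] (W : Setup K t c)
  [Fact t.Prime] [ProperSpace K] [MeasurableSpace K] [BorelSpace K] (μ : Measure K)
  [μ.IsAddHaarMeasure]

/-- The character `χ(z ·)` cut off to the unit ball around `v`. -/
def wave (z v : K) : K → ℂ := (Metric.closedBall v 1).indicator (W.e z)

omit [Fact t.Prime] in
lemma memLp_wave (z v : K) : MemLp (W.wave z v) 2 μ := by
  rw [wave, memLp_indicator_iff_restrict Metric.isClosed_closedBall.measurableSet]
  have : IsFiniteMeasure (μ.restrict (Metric.closedBall v 1)) :=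
    ⟨by simpa using (isCompact_closedBall v 1).measure_lt_top⟩
  exact MemLp.of_bound (W.continuous_e z).aestronglyMeasurable 1 (ae_of_all _ fun x => by simp)

omit [Fact t.Prime] in
lemma _root_.MeasureTheory.MemLp.integrableOn_closedBall {f : K → ℂ} (hf : MemLp f 2 μ) (v : K)
    (r : ℝ) : IntegrableOn f (Metric.closedBall v r) μ := by
  have : IsFiniteMeasure (μ.restrict (Metric.closedBall v r)) :=
    ⟨by simpa using (isCompact_closedBall v r).measure_lt_top⟩
  exact (hf.restrict _).integrable one_le_two

omit [Fact t.Prime] in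
lemma inner_wave (z v : K) {f : K → ℂ} (hf : MemLp f 2 μ) :
    inner ℂ ((W.memLp_wave μ z v).toLp (W.wave z v)) (hf.toLp f) =
      ∫ x in Metric.closedBall v 1, W.e (-z) x * f x ∂μ := by
  rw [← innerL2_eq_inner, innerL2, ← integral_indicator Metric.isClosed_closedBall.measurableSet]
  congr 1
  ext x
  by_cases hx : x ∈ Metric.closedBall v 1
  · simp only [wave, Set.indicator_of_mem hx, conj_e, mul_comm]
  · simp only [wave, Set.indicator_of_notMem hx, map_zero, mul_zero]

/-- The vectors of the time-frequency basis of `L²(K)`. -/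
def waveLp (p : W.lattice × W.lattice) : Lp ℂ 2 μ :=
  (W.memLp_wave μ (p.1 : K) p.2).toLp (W.wave p.1 p.2)

variable [IsUltrametricDist K]

/-- Distinct cosets v + D are disjoint. On a common coset the inner product is ∫ χ((z'-z)·), which
translates to D by periodicity and vanishes unless z' - z ∈ Λ ∩ D = 0. -/
lemma orthonormal_waveLp (hμ : μ (Metric.closedBall 0 1) = 1) : Orthonormal ℂ (W.waveLp μ) := by
  classical
  rw [orthonormal_iff_ite]
  rintro ⟨z, v⟩ ⟨z', v'⟩
  rw [waveLp, waveLp, inner_wave]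
  dsimp only
  by_cases hv : v = v'
  · subst hv
    have h1 : ∫ x in Metric.closedBall (v : K) 1, W.e (-z) x * W.wave z' v x ∂μ =
        ∫ x in Metric.closedBall (v : K) 1, W.e (z' - z) x ∂μ := by
      refine setIntegral_congr_fun Metric.isClosed_closedBall.measurableSet fun x hx => ?_
      simp only [wave, Set.indicator_of_mem hx]
      rw [← e_add_left, neg_add_eq_sub]
    rw [h1, setIntegral_closedBall_add]
    simp only [W.e_add_lattice (sub_mem z'.2 z.2) v.2]
    rw [W.integral_e μ hμ]
    congr 1
    simp only [Prod.mk.injEq, and_true, eq_iff_iff]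
    constructor
    · intro h
      exact Subtype.ext (sub_eq_zero.1 (W.eq_zero_of_mem_lattice (sub_mem z'.2 z.2) h)).symm
    · rintro rfl
      simp
  · rw [if_neg (by simp [hv])]
    have h0 : ∀ x ∈ Metric.closedBall (v : K) 1, W.e (-z) x * W.wave z' v' x = 0 := by
      intro x hx
      rw [wave, Set.indicator_of_notMem, mul_zero]
      exact Set.disjoint_left.1 (W.pairwise_disjoint_closedBall_lattice hv) hx
    rw [setIntegral_congr_fun Metric.isClosed_closedBall.measurableSet h0]
    simp

lemma eq_zero_of_inner_waveLp {f : Lp ℂ 2 μ} (h : ∀ p, inner ℂ (W.waveLp μ p) f = 0) : f = 0 := by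
  have hf := Lp.memLp f
  rw [Lp.eq_zero_iff_ae_eq_zero]
  refine W.ae_eq_zero_of_forall_coeff_eq_zero μ (fun v _ => hf.integrableOn_closedBall μ v 1)
    fun z hz v hv => ?_
  -- The minus sign offsets the conjugation in the inner product.
  have := h (-⟨z, hz⟩, ⟨v, hv⟩)
  rw [← Lp.toLp_coeFn f hf, waveLp, inner_wave] at this
  simpa using this

lemma span_waveLp_orthogonal {ι : Type*} {σ : ι → W.lattice × W.lattice}
    (hσ : Function.Surjective σ) :
    (Submodule.span ℂ (Set.range fun i => W.waveLp μ (σ i)))ᗮ = ⊥ := by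
  rw [Submodule.eq_bot_iff]
  intro f hf
  refine W.eq_zero_of_inner_waveLp μ fun p => ?_
  obtain ⟨i, rfl⟩ := hσ p
  exact hf _ (Submodule.subset_span ⟨i, rfl⟩)

/-- The Fourier transform exchanges position and frequency. -/
def swapWave (p : W.lattice × W.lattice) : W.lattice × W.lattice := (-p.2, p.1)

omit [ProperSpace K] [MeasurableSpace K] [BorelSpace K] [IsUltrametricDist K] in
lemma swapWave_bijective : Function.Bijective W.swapWave :=
  ⟨fun p p' h => by
    simp only [swapWave, Prod.mk.injEq, neg_inj] at h
    exact Prod.ext h.2 h.1, fun p => ⟨(p.2, -p.1), by simp [swapWave]⟩⟩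

variable (hμ : μ (Metric.closedBall 0 1) = 1)

/-- The time-frequency basis of `L²(K)`. -/
def waveBasis : HilbertBasis (W.lattice × W.lattice) ℂ (Lp ℂ 2 μ) :=
  HilbertBasis.mkOfOrthogonalEqBot (W.orthonormal_waveLp μ hμ)
    (W.span_waveLp_orthogonal μ (σ := id) Function.surjective_id)

/-- The Fourier transform of the time-frequency basis. -/
def waveBasisSwap : HilbertBasis (W.lattice × W.lattice) ℂ (Lp ℂ 2 μ) :=
  HilbertBasis.mkOfOrthogonalEqBot
    ((W.orthonormal_waveLp μ hμ).comp W.swapWave W.swapWave_bijective.1)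
    (W.span_waveLp_orthogonal μ W.swapWave_bijective.2)

/-- The Fourier transform on `L²(K)`. -/
def fourierL2 : Lp ℂ 2 μ ≃ₗᵢ[ℂ] Lp ℂ 2 μ :=
  (W.waveBasis μ hμ).repr.trans (W.waveBasisSwap μ hμ).repr.symm

lemma fourierL2_waveLp (p : W.lattice × W.lattice) :
    W.fourierL2 μ hμ (W.waveLp μ p) = W.waveLp μ (W.swapWave p) := by
  classical
  have h1 : W.waveLp μ p = W.waveBasis μ hμ p := by
    rw [waveBasis, HilbertBasis.coe_mkOfOrthogonalEqBot]
  have h2 : W.waveLp μ (W.swapWave p) = W.waveBasisSwap μ hμ p := by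
    rw [waveBasisSwap, HilbertBasis.coe_mkOfOrthogonalEqBot]
    rfl
  rw [h1, h2, fourierL2, LinearIsometryEquiv.trans_apply, HilbertBasis.repr_self,
    HilbertBasis.repr_symm_single]

omit [Fact t.Prime] [μ.IsAddHaarMeasure] [ProperSpace K] [IsUltrametricDist K] in
lemma fourierIntegral_eq (f : K → ℂ) (ξ : K) :
    W.fourierIntegral μ f ξ = ∫ x, W.e (-ξ) x * f x ∂μ := by
  unfold fourierIntegral
  congr 1
  ext x
  rw [mul_comm, ← conj_e]
  rfl

omit [Fact t.Prime] [μ.IsAddHaarMeasure] [ProperSpace K] [IsUltrametricDist K]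
  [MeasurableSpace K] [BorelSpace K] in
lemma continuous_e_comp {X : Type*} [TopologicalSpace X] {f g : X → K} (hf : Continuous f)
    (hg : Continuous g) : Continuous fun x => W.e (f x) (g x) := by
  have := W.χ_continuous
  unfold e
  fun_prop

lemma continuous_fourierIntegral {f : K → ℂ} (hf : Integrable f μ) :
    Continuous (W.fourierIntegral μ f) := by
  simp only [funext (W.fourierIntegral_eq μ f)]
  refine continuous_of_dominated (bound := fun x => ‖f x‖)
    (fun ξ => (W.integrable_e_mul _ hf).aestronglyMeasurable)
    (fun ξ => ae_of_all _ fun x => by simp) hf.norm (ae_of_all _ fun x => ?_)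
  exact (W.continuous_e_comp continuous_neg continuous_const).mul_const _

lemma integrableOn_fourierIntegral {f : K → ℂ} (hf : Integrable f μ) (v : K) :
    IntegrableOn (W.fourierIntegral μ f) (Metric.closedBall v 1) μ :=
  (W.continuous_fourierIntegral μ hf).locallyIntegrable.integrableOn_isCompact
    (isCompact_closedBall v 1)

include hμ in
-- By Fubini the inner integral of χ((z-x)·) over v + D is χ(zv)χ(-xv) for x ∈ z + D and zero
-- otherwise, and χ(zv) = 1.
lemma coeff_fourierIntegral {f : K → ℂ} (hf : Integrable f μ) {z v : K} (hz : z ∈ W.lattice)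
    (hv : v ∈ W.lattice) :
    ∫ ξ in Metric.closedBall v 1, W.e z ξ * W.fourierIntegral μ f ξ ∂μ =
      ∫ x in Metric.closedBall z 1, W.e (-v) x * f x ∂μ := by
  have : IsFiniteMeasure (μ.restrict (Metric.closedBall v 1)) :=
    ⟨by simpa using (isCompact_closedBall v 1).measure_lt_top⟩
  have hint : Integrable (fun p : K × K => W.e (z - p.2) p.1 * f p.2)
      ((μ.restrict (Metric.closedBall v 1)).prod μ) :=
    (hf.comp_snd _).bdd_mul (c := 1)
      (W.continuous_e_comp (by fun_prop) continuous_fst).aestronglyMeasurable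
      (ae_of_all _ fun x => by simp)
  have h1 : ∀ ξ, W.e z ξ * W.fourierIntegral μ f ξ = ∫ x, W.e (z - x) ξ * f x ∂μ := by
    intro ξ
    rw [fourierIntegral_eq, ← integral_const_mul]
    congr 1
    ext x
    rw [sub_eq_add_neg, e_add_left, W.e_comm (-ξ) x, e_neg_right, mul_assoc]
  simp only [h1]
  rw [integral_integral_swap hint, ← integral_indicator Metric.isClosed_closedBall.measurableSet]
  congr 1
  ext x
  rw [integral_mul_const, setIntegral_closedBall_add]
  simp only [e_add_right]
  rw [integral_mul_const, W.integral_e μ hμ]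
  have h2 : ‖z - x‖ ≤ 1 ↔ x ∈ Metric.closedBall z 1 := by
    rw [Metric.mem_closedBall, dist_comm, dist_eq_norm]
  by_cases hx : x ∈ Metric.closedBall z 1
  · rw [if_pos (h2.2 hx), Set.indicator_of_mem hx, one_mul, sub_eq_add_neg, e_add_left,
      W.e_lattice hz hv, one_mul, W.e_comm (-x) v, e_neg_right]
  · rw [if_neg (h2.not.2 hx), Set.indicator_of_notMem hx, zero_mul, zero_mul]

/-- On `L¹ ∩ L²` the Fourier transform is the integral. -/
lemma fourierL2_ae_eq {f : K → ℂ} (hf : Integrable f μ) (hf2 : MemLp f 2 μ) :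
    W.fourierL2 μ hμ (hf2.toLp f) =ᵐ[μ] W.fourierIntegral μ f := by
  set G := W.fourierL2 μ hμ (hf2.toLp f) with hG
  have hG2 := Lp.memLp G
  have key := W.ae_eq_zero_of_forall_coeff_eq_zero μ (P := fun ξ => G ξ - W.fourierIntegral μ f ξ)
    (fun v _ => (hG2.integrableOn_closedBall μ v 1).sub (W.integrableOn_fourierIntegral μ hf v))
    fun z hz v hv => ?_
  · filter_upwards [key] with ξ hξ
    exact sub_eq_zero.1 hξ
  · simp only [mul_sub]
    rw [integral_sub (W.integrable_e_mul z (hG2.integrableOn_closedBall μ v 1))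
      (W.integrable_e_mul z (W.integrableOn_fourierIntegral μ hf v)),
      W.coeff_fourierIntegral μ hμ hf hz hv, sub_eq_zero]
    -- The isometry carries the wave (v, z) to (-z, v), so the coefficient of G is the one of f
    -- found in `coeff_fourierIntegral`.
    have h1 : inner ℂ (W.waveLp μ (⟨v, hv⟩, ⟨z, hz⟩)) (hf2.toLp f) =
        inner ℂ (W.waveLp μ (-⟨z, hz⟩, ⟨v, hv⟩)) G := by
      rw [hG, ← (W.fourierL2 μ hμ).inner_map_map, fourierL2_waveLp, swapWave]
    rw [← Lp.toLp_coeFn G hG2, waveLp, waveLp, inner_wave, inner_wave] at h1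
    simpa using h1.symm

/-- Both directions use continuity of the isometry and its agreement with the integral on L¹ ∩ L²;
the converse takes compactly supported continuous approximants. -/
lemma isFourierL2_iff {f g : K → ℂ} (hf : MemLp f 2 μ) (hg : MemLp g 2 μ) :
    W.IsFourierL2 μ f g ↔ W.fourierL2 μ hμ (hf.toLp f) = hg.toLp g := by
  have hmem : ∀ s : K → ℂ, Integrable s μ → MemLp s 2 μ → MemLp (W.fourierIntegral μ s) 2 μ :=
    fun s h1 h2 => (memLp_congr_ae (W.fourierL2_ae_eq μ hμ h1 h2)).1 (Lp.memLp _)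
  have htoLp : ∀ (s : K → ℂ) (h1 : Integrable s μ) (h2 : MemLp s 2 μ),
      (hmem s h1 h2).toLp _ = W.fourierL2 μ hμ (h2.toLp s) := by
    intro s h1 h2
    rw [← Lp.toLp_coeFn (W.fourierL2 μ hμ (h2.toLp s)) (Lp.memLp _)]
    exact MemLp.toLp_congr _ _ (W.fourierL2_ae_eq μ hμ h1 h2).symm
  constructor
  · rintro ⟨-, -, s, hs, hsf, hsg⟩
    rw [← tendsto_toLp_iff (fun n => (hs n).2) hf] at hsf
    rw [← tendsto_toLp_iff (fun n => hmem _ (hs n).1 (hs n).2) hg] at hsg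
    refine tendsto_nhds_unique (((W.fourierL2 μ hμ).continuous.tendsto _).comp hsf) ?_
    refine hsg.congr fun n => ?_
    exact htoLp _ (hs n).1 (hs n).2
  · intro h
    have hε : ∀ n : ℕ, ((n : ENNReal) + 1)⁻¹ ≠ 0 := fun n => by simp
    choose s hs1 hs2 hs3 hs4 using fun n =>
      hf.exists_hasCompactSupport_eLpNorm_sub_le ENNReal.ofNat_ne_top (hε n)
    have hsi : ∀ n, Integrable (s n) μ := fun n => (hs3 n).integrable_of_hasCompactSupport (hs1 n)
    have hlim : Tendsto (fun n => eLpNorm (s n - f) 2 μ) atTop (𝓝 0) := by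
      refine tendsto_of_tendsto_of_tendsto_of_le_of_le tendsto_const_nhds
        (h := fun n : ℕ => ((n : ENNReal) + 1)⁻¹) ?_ (fun n => zero_le) (fun n => ?_)
      · have := ENNReal.tendsto_inv_nat_nhds_zero.comp (tendsto_add_atTop_nat 1)
        refine this.congr fun n => ?_
        simp
      · dsimp only
        rw [eLpNorm_sub_comm]
        exact hs2 n
    refine ⟨hf, hg, s, fun n => ⟨hsi n, hs4 n⟩, hlim, ?_⟩
    rw [← tendsto_toLp_iff (fun n => hmem _ (hsi n) (hs4 n)) hg, ← h]
    rw [← tendsto_toLp_iff hs4 hf] at hlim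
    refine (((W.fourierL2 μ hμ).continuous.tendsto _).comp hlim).congr fun n => ?_
    exact (htoLp _ (hsi n) (hs4 n)).symm

include hμ in
lemma exists_fourierL2 {f : K → ℂ} (hf : MemLp f 2 μ) : ∃ g, W.IsFourierL2 μ f g := by
  refine ⟨_, (W.isFourierL2_iff μ hμ hf (Lp.memLp (W.fourierL2 μ hμ (hf.toLp f)))).2 ?_⟩
  rw [Lp.toLp_coeFn]

include hμ in
lemma exists_fourierL2_symm {g : K → ℂ} (hg : MemLp g 2 μ) : ∃ f, W.IsFourierL2 μ f g := by
  refine ⟨_, (W.isFourierL2_iff μ hμ (Lp.memLp ((W.fourierL2 μ hμ).symm (hg.toLp g))) hg).2 ?_⟩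
  rw [Lp.toLp_coeFn, LinearIsometryEquiv.apply_symm_apply]

include hμ in
/-- Parseval's identity. -/
lemma innerL2_fourier {f g fhat ghat : K → ℂ} (hf : W.IsFourierL2 μ f fhat)
    (hg : W.IsFourierL2 μ g ghat) : innerL2 μ f g = innerL2 μ fhat ghat := by
  rw [innerL2_eq_inner hf.1 hg.1, innerL2_eq_inner hf.2.1 hg.2.1,
    ← (W.isFourierL2_iff μ hμ hf.1 hf.2.1).1 hf, ← (W.isFourierL2_iff μ hμ hg.1 hg.2.1).1 hg,
    LinearIsometryEquiv.inner_map_map]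

end Setup

/-! ### Haar measure under multiplication -/

section Scale

variable {K : Type*} [NontriviallyNormedField K] [ProperSpace K] [MeasurableSpace K] [BorelSpace K]
  (μ : Measure K) [μ.IsAddHaarMeasure]

/-- Multiplication by α is a topological automorphism of the additive group, so uniqueness of Haar
measure applies. -/
lemma exists_map_mul_eq_smul {α : K} (hα : α ≠ 0) :
    ∃ κ : NNReal, μ.map (α * ·) = κ • μ := by
  have h : (μ.map (AddAut.mulLeft (Units.mk0 α hα))).IsAddHaarMeasure :=
    AddEquiv.isAddHaarMeasure_map μ (AddAut.mulLeft (Units.mk0 α hα)) (continuous_const_mul α)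
      (continuous_const_mul α⁻¹)
  exact ⟨_, Measure.isAddLeftInvariant_eq_smul (μ.map (AddAut.mulLeft (Units.mk0 α hα))) μ⟩

open Classical in
/-- The factor by which multiplication by `α` rescales the Haar measure. -/
def scale (α : K) : NNReal := if hα : α ≠ 0 then (exists_map_mul_eq_smul μ hα).choose else 0

lemma map_mul_eq_scale {α : K} (hα : α ≠ 0) : μ.map (α * ·) = scale μ α • μ := by
  rw [scale, dif_pos hα]
  exact (exists_map_mul_eq_smul μ hα).choose_spec

omit [ProperSpace K] in
lemma measurableEmbedding_mul {α : K} (hα : α ≠ 0) : MeasurableEmbedding (α * · : K → K) :=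
  (Homeomorph.mulLeft₀ α hα).measurableEmbedding

lemma integral_comp_mul {α : K} (hα : α ≠ 0) (f : K → ℂ) :
    ∫ x, f (α * x) ∂μ = scale μ α * ∫ x, f x ∂μ := by
  rw [← (measurableEmbedding_mul hα).integral_map, map_mul_eq_scale μ hα,
    integral_smul_nnreal_measure]
  rfl

lemma eLpNorm_comp_mul {α : K} (hα : α ≠ 0) (f : K → ℂ) :
    eLpNorm (fun x => f (α * x)) 2 μ =
      (scale μ α : ENNReal) ^ (1 / (2 : ENNReal)).toReal * eLpNorm f 2 μ := by
  change eLpNorm (f ∘ (α * ·)) 2 μ = _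
  rw [← (measurableEmbedding_mul hα).eLpNorm_map_measure, map_mul_eq_scale μ hα]
  exact eLpNorm_smul_measure_of_ne_top (by simp) f (scale μ α : ENNReal)

lemma quasiMeasurePreserving_mul {α : K} (hα : α ≠ 0) :
    Measure.QuasiMeasurePreserving (α * · : K → K) μ μ :=
  ⟨(measurableEmbedding_mul hα).measurable, by
    rw [map_mul_eq_scale μ hα]; exact Measure.smul_absolutelyContinuous⟩

variable {μ}

lemma _root_.MeasureTheory.MemLp.comp_mul {f : K → ℂ} (hf : MemLp f 2 μ) {α : K} (hα : α ≠ 0) :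
    MemLp (fun x => f (α * x)) 2 μ := by
  refine ⟨hf.1.comp_quasiMeasurePreserving (quasiMeasurePreserving_mul μ hα), ?_⟩
  rw [eLpNorm_comp_mul μ hα]
  exact ENNReal.mul_lt_top (ENNReal.rpow_lt_top_of_nonneg (by simp) ENNReal.coe_ne_top) hf.2

lemma _root_.MeasureTheory.Integrable.comp_mul_left₀ {f : K → ℂ} (hf : Integrable f μ) {α : K}
    (hα : α ≠ 0) : Integrable (fun x => f (α * x)) μ := by
  change Integrable (f ∘ (α * ·)) μ
  rw [← (measurableEmbedding_mul hα).integrable_map_iff, map_mul_eq_scale μ hα]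
  exact hf.smul_measure_nnreal

lemma tendsto_eLpNorm_comp_mul {α : K} (hα : α ≠ 0) {s : ℕ → K → ℂ}
    (h : Tendsto (fun n => eLpNorm (s n) 2 μ) atTop (𝓝 0)) :
    Tendsto (fun n => eLpNorm (fun x => s n (α * x)) 2 μ) atTop (𝓝 0) := by
  simp only [eLpNorm_comp_mul μ hα]
  have := ENNReal.Tendsto.const_mul (a := (scale μ α : ENNReal) ^ (1 / (2 : ENNReal)).toReal) h
    (Or.inr (ENNReal.rpow_lt_top_of_nonneg (by simp) ENNReal.coe_ne_top).ne)
  simpa using this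

omit [ProperSpace K] in
lemma _root_.MeasureTheory.MemLp.comp_sub {f : K → ℂ} (hf : MemLp f 2 μ) (v : K) :
    MemLp (fun x => f (x - v)) 2 μ :=
  hf.comp_measurePreserving (measurePreserving_sub_right μ v)

omit [ProperSpace K] in
lemma eLpNorm_comp_sub {f : K → ℂ} (hf : AEStronglyMeasurable f μ) (v : K) :
    eLpNorm (fun x => f (x - v)) 2 μ = eLpNorm f 2 μ :=
  eLpNorm_comp_measurePreserving hf (measurePreserving_sub_right μ v)

end Scale

/-! ### Translations, dilations and the two-scale relation under the Fourier transform -/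

namespace Setup

variable {K : Type*} [NontriviallyNormedField K] {t c : ℕ} [NeZero c] {W : Setup K t c}
  [Fact t.Prime] [ProperSpace K] [MeasurableSpace K] [BorelSpace K] {μ : Measure K}
  [μ.IsAddHaarMeasure]

lemma _root_.MeasureTheory.MemLp.e_mul {f : K → ℂ} (hf : MemLp f 2 μ) (W : Setup K t c) (z : K) :
    MemLp (fun x => W.e z x * f x) 2 μ :=
  hf.of_le ((W.continuous_e z).aestronglyMeasurable.mul hf.1) (ae_of_all _ fun x => by simp)

lemma eLpNorm_e_mul (f : K → ℂ) (z : K) :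
    eLpNorm (fun x => W.e z x * f x) 2 μ = eLpNorm f 2 μ :=
  eLpNorm_congr_norm_ae (ae_of_all _ fun x => by simp)

lemma IsFourierL2.comp_sub {f g : K → ℂ} (h : W.IsFourierL2 μ f g) (v : K) :
    W.IsFourierL2 μ (fun x => f (x - v)) (fun ξ => W.e (-v) ξ * g ξ) := by
  obtain ⟨hf, hg, s, hs, hsf, hsg⟩ := h
  refine ⟨hf.comp_sub v, hg.e_mul W _, fun n x => s n (x - v),
    fun n => ⟨(hs n).1.comp_sub_right v, (hs n).2.comp_sub v⟩, ?_, ?_⟩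
  · refine hsf.congr fun n => ?_
    exact (eLpNorm_comp_sub ((hs n).2.1.sub hf.1) v).symm
  · refine hsg.congr fun n => ?_
    rw [← eLpNorm_e_mul (W := W) _ (-v)]
    congr 1
    ext ξ
    simp only [Pi.sub_apply, mul_sub, sub_left_inj]
    rw [fourierIntegral_eq, fourierIntegral_eq, ← integral_const_mul,
      ← integral_sub_right_eq_self _ v]
    congr 1
    ext x
    rw [← mul_assoc]
    congr 1
    rw [W.e_comm (-v) ξ, e_neg_right, ← e_add_right, add_sub_cancel]

lemma IsFourierL2.comp_mul {f g : K → ℂ} (h : W.IsFourierL2 μ f g) {α : K} (hα : α ≠ 0) :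
    W.IsFourierL2 μ (fun x => f (α * x)) (fun ξ => (scale μ α : ℂ) * g (α⁻¹ * ξ)) := by
  obtain ⟨hf, hg, s, hs, hsf, hsg⟩ := h
  have hf' := hf.comp_mul hα
  have hg' := (hg.comp_mul (inv_ne_zero hα)).const_mul (scale μ α : ℂ)
  have hs1 : ∀ n, Integrable (fun x => s n (α * x)) μ := fun n => (hs n).1.comp_mul_left₀ hα
  have hs2 : ∀ n, MemLp (fun x => s n (α * x)) 2 μ := fun n => (hs n).2.comp_mul hα
  have hsf' := tendsto_eLpNorm_comp_mul hα hsf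
  refine ⟨hf', hg', fun n x => s n (α * x), fun n => ⟨hs1 n, hs2 n⟩, hsf', ?_⟩
  have h1 := tendsto_eLpNorm_comp_mul (inv_ne_zero hα) hsg
  have h2 := ENNReal.Tendsto.const_mul (a := ‖(scale μ α : ℂ)‖ₑ) h1 (Or.inr (by simp))
  rw [mul_zero] at h2
  refine h2.congr fun n => ?_
  have h3 : W.fourierIntegral μ (fun x => s n (α * x)) - (fun ξ => (scale μ α : ℂ) * g (α⁻¹ * ξ)) =
      (scale μ α : ℂ) • fun ξ => (W.fourierIntegral μ (s n) - g) (α⁻¹ * ξ) := by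
    ext ξ
    simp only [Pi.smul_apply, Pi.sub_apply, smul_eq_mul, mul_sub, sub_left_inj]
    rw [fourierIntegral_eq, fourierIntegral_eq, ← integral_comp_mul μ hα]
    congr 1
    ext x
    rw [e_mul_assoc, neg_mul, mul_right_comm, inv_mul_cancel₀ hα, one_mul]
  rw [h3, eLpNorm_const_smul]

variable [IsUltrametricDist K] (hμ : μ (Metric.closedBall 0 1) = 1)
include hμ

lemma IsFourierL2.add {f g f' g' : K → ℂ} (h : W.IsFourierL2 μ f g) (h' : W.IsFourierL2 μ f' g') :
    W.IsFourierL2 μ (f + f') (g + g') := by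
  have h1 := (W.isFourierL2_iff μ hμ h.1 h.2.1).1 h
  have h2 := (W.isFourierL2_iff μ hμ h'.1 h'.2.1).1 h'
  rw [W.isFourierL2_iff μ hμ (h.1.add h'.1) (h.2.1.add h'.2.1), MemLp.toLp_add h.1 h'.1, map_add,
    h1, h2, MemLp.toLp_add]

lemma IsFourierL2.const_mul {f g : K → ℂ} (h : W.IsFourierL2 μ f g) (a : ℂ) :
    W.IsFourierL2 μ (fun x => a * f x) (fun x => a * g x) := by
  have h1 := (W.isFourierL2_iff μ hμ h.1 h.2.1).1 h
  rw [W.isFourierL2_iff μ hμ (h.1.const_mul a) (h.2.1.const_mul a)]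
  change W.fourierL2 μ hμ ((h.1.const_smul a).toLp (a • f)) = (h.2.1.const_smul a).toLp (a • g)
  rw [MemLp.toLp_const_smul a h.1, map_smul, h1, MemLp.toLp_const_smul]

lemma IsFourierL2.zero : W.IsFourierL2 μ 0 0 := by
  rw [W.isFourierL2_iff μ hμ MemLp.zero MemLp.zero, MemLp.toLp_zero, map_zero]

lemma IsFourierL2.sum {s : Finset ℕ} {f g : ℕ → K → ℂ} (h : ∀ i, W.IsFourierL2 μ (f i) (g i)) :
    W.IsFourierL2 μ (fun x => ∑ i ∈ s, f i x) (fun x => ∑ i ∈ s, g i x) := by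
  induction s using Finset.cons_induction with
  | empty => exact IsFourierL2.zero hμ
  | cons i s hi ih =>
    simp only [Finset.sum_cons]
    exact (h i).add hμ ih

/-- Plancherel's theorem. -/
lemma IsFourierL2.eLpNorm_sub {f g f' g' : K → ℂ} (h : W.IsFourierL2 μ f g)
    (h' : W.IsFourierL2 μ f' g') : eLpNorm (g - g') 2 μ = eLpNorm (f - f') 2 μ := by
  have h1 := (W.isFourierL2_iff μ hμ h.1 h.2.1).1 h
  have h2 := (W.isFourierL2_iff μ hμ h'.1 h'.2.1).1 h'
  have h3 : ‖(h.2.1.sub h'.2.1).toLp (g - g')‖ = ‖(h.1.sub h'.1).toLp (f - f')‖ := by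
    rw [MemLp.toLp_sub h.2.1 h'.2.1, ← h1, ← h2, ← map_sub, LinearIsometryEquiv.norm_map,
      ← MemLp.toLp_sub]
  rw [Lp.norm_toLp, Lp.norm_toLp] at h3
  exact (ENNReal.toReal_eq_toReal_iff' (h.2.1.sub h'.2.1).2.ne (h.1.sub h'.1).2.ne).1 h3

/-- The factor is the measure of ϖD, and D is the disjoint union of its q translates by the residue
digits. -/
lemma scale_inv_ϖ : (scale μ W.ϖ⁻¹ : ℝ) = W.q⁻¹ := by
  have h0 := W.ϖ_ne_zero
  have h1 : scale μ W.ϖ⁻¹ = μ (Metric.closedBall 0 ‖W.ϖ‖) := by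
    have h2 := map_mul_eq_scale μ (inv_ne_zero h0)
    have h3 := congrArg (fun ν : Measure K => ν (Metric.closedBall 0 1)) h2
    simp only [Measure.smul_apply, hμ] at h3
    rw [(measurableEmbedding_mul (inv_ne_zero h0)).map_apply] at h3
    have h4 : (W.ϖ⁻¹ * ·) ⁻¹' Metric.closedBall (0 : K) 1 = Metric.closedBall 0 ‖W.ϖ‖ := by
      ext x
      simp [inv_mul_le_one₀ W.ϖ_norm_pos]
    rw [h4] at h3
    rw [h3, ENNReal.smul_def, smul_eq_mul, mul_one]
  have h5 : Metric.closedBall (0 : K) 1 =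
      ⋃ b ∈ Finset.range (t ^ c), Metric.closedBall (W.digit b) ‖W.ϖ‖ := by
    ext x
    simp only [Set.mem_iUnion, Finset.mem_range, exists_prop, mem_closedBall_zero_iff]
    constructor
    · intro hx
      obtain ⟨b, hb, hbx⟩ := W.exists_digit_sub_lt hx
      exact ⟨b, hb, by rw [Metric.mem_closedBall, dist_eq_norm]; exact W.ϖ_max _ hbx⟩
    · rintro ⟨b, hb, hbx⟩
      rw [Metric.mem_closedBall, dist_eq_norm] at hbx
      have := IsUltrametricDist.norm_add_le_max (x - W.digit b) (W.digit b)
      rw [sub_add_cancel] at this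
      exact this.trans (max_le (hbx.trans W.ϖ_lt_one.le) (W.norm_digit_le b))
  have h6 : ((t ^ c : ℕ) : ENNReal) * scale μ W.ϖ⁻¹ = 1 := by
    rw [← hμ, h5, measure_biUnion_finset, h1]
    · have : ∀ b, μ (Metric.closedBall (W.digit b) ‖W.ϖ‖) = μ (Metric.closedBall 0 ‖W.ϖ‖) :=
        fun b => Measure.addHaar_closedBall_center μ _ _
      simp [this]
    · intro a ha b hb hab
      refine Set.disjoint_left.2 fun x hxa hxb => hab ?_
      rw [Metric.mem_closedBall, dist_eq_norm] at hxa hxb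
      refine W.eq_of_digit_norm_sub_lt (by simpa using ha) (by simpa using hb) ?_
      have : W.digit a - W.digit b = (x - W.digit b) - (x - W.digit a) := by ring
      rw [this]
      exact ((norm_sub_le_max_norm _ _).trans (max_le hxb hxa)).trans_lt W.ϖ_lt_one
    · exact fun b _ => Metric.isClosed_closedBall.measurableSet
  have h7 : W.q * (scale μ W.ϖ⁻¹ : ℝ) = 1 := by
    have h8 : ((t ^ c : ℕ) : NNReal) * scale μ W.ϖ⁻¹ = 1 := by exact_mod_cast h6
    have h9 := congrArg NNReal.toReal h8
    simpa [q] using h9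
  exact eq_inv_of_mul_eq_one_right h7

/-- The Fourier transform of a function defined by a two-scale relation. -/
lemma fourier_twoScale {φ φhat ψ ψhat : K → ℂ} (hφ : W.IsFourierL2 μ φ φhat)
    (hψ : W.IsFourierL2 μ ψ ψhat) {d : ℕ → ℂ} {m : K → ℂ} (hm : W.IsMask μ d m)
    (hd : W.TwoScale μ φ d ψ) : ∀ᵐ ξ ∂μ, ψhat (W.ϖ⁻¹ * ξ) = m ξ * φhat ξ := by
  have h0 := W.ϖ_ne_zero
  have hq : 0 < W.q := by
    have := (Fact.out : t.Prime).pos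
    unfold q
    positivity
  set p : ℕ → K → ℂ := fun n ξ => ((1 / √W.q : ℝ) : ℂ) *
    ∑ k ∈ Finset.range n, d k * starRingEnd ℂ (W.χ (W.u k * ξ) : ℂ) with hp
  have hpc : ∀ n, Continuous (p n) := fun n => by
    refine continuous_const.mul (continuous_finsetSum _ fun k _ => continuous_const.mul ?_)
    exact RCLike.continuous_conj.comp (W.continuous_e _)
  have hs : ∀ n, W.IsFourierL2 μ (fun x => ((√W.q : ℝ) : ℂ) *
      ∑ k ∈ Finset.range n, d k * φ (W.ϖ⁻¹ * x - W.u k))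
      (fun ξ => p n (W.ϖ * ξ) * φhat (W.ϖ * ξ)) := by
    intro n
    have h1 := (IsFourierL2.sum (W := W) hμ (s := Finset.range n) fun k =>
      (((hφ.comp_sub (W.u k)).comp_mul (inv_ne_zero h0)).const_mul hμ (d k))).const_mul hμ
        ((√W.q : ℝ) : ℂ)
    convert h1 using 2 with ξ
    rw [inv_inv, hp]
    simp only
    rw [Finset.mul_sum, Finset.mul_sum, Finset.sum_mul]
    refine Finset.sum_congr rfl fun k _ => ?_
    have h2 : starRingEnd ℂ (W.χ (W.u k * (W.ϖ * ξ)) : ℂ) = W.e (-W.u k) (W.ϖ * ξ) := W.conj_e _ _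
    have h3 : (scale μ W.ϖ⁻¹ : ℂ) = ((W.q⁻¹ : ℝ) : ℂ) := by
      rw [← scale_inv_ϖ (W := W) hμ]
    have h4 : (1 / √W.q : ℝ) = √W.q * W.q⁻¹ := by
      rw [← div_eq_mul_inv, Real.sqrt_div_self']
    rw [h2, h3, h4]
    push_cast
    ring
  have h1 : Tendsto (fun n => eLpNorm ((fun ξ => p n (W.ϖ * ξ) * φhat (W.ϖ * ξ)) - ψhat) 2 μ)
      atTop (𝓝 0) := by
    refine hd.congr fun n => ?_
    rw [(hs n).eLpNorm_sub hμ hψ, eLpNorm_sub_comm]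
    rfl
  have h2 := tendsto_eLpNorm_comp_mul (inv_ne_zero h0) h1
  simp only [Pi.sub_apply, mul_inv_cancel_left₀ h0] at h2
  -- The products converge in L²(K), but the mask series only in L² on balls. The limits are
  -- therefore compared pointwise, along a.e. convergent subsequences, ball by ball.
  have h3 : TendstoInMeasure μ (fun n ξ => p n ξ * φhat ξ) atTop (fun ξ => ψhat (W.ϖ⁻¹ * ξ)) :=
    tendstoInMeasure_of_tendsto_eLpNorm two_ne_zero
      (fun n => (hpc n).aestronglyMeasurable.mul hφ.2.1.1)
      (hψ.2.1.comp_mul (inv_ne_zero h0)).1 h2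
  obtain ⟨ns, hns, h4⟩ := h3.exists_seq_tendsto_ae
  have key : ∀ R : ℕ, ∀ᵐ ξ ∂μ, ξ ∈ Metric.closedBall (0 : K) R →
      ψhat (W.ϖ⁻¹ * ξ) = m ξ * φhat ξ := by
    intro R
    rw [← ae_restrict_iff' Metric.isClosed_closedBall.measurableSet]
    have h5 := (hm.2 R).comp hns.tendsto_atTop
    have h6 : TendstoInMeasure (μ.restrict (Metric.closedBall 0 R)) (fun n => p (ns n)) atTop m := by
      refine tendstoInMeasure_of_tendsto_eLpNorm two_ne_zero
        (fun n => (hpc _).aestronglyMeasurable) hm.1.restrict (h5.congr fun n => ?_)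
      rw [eLpNorm_sub_comm]
      rfl
    obtain ⟨ns', hns', h7⟩ := h6.exists_seq_tendsto_ae
    filter_upwards [h7, ae_restrict_of_ae h4] with ξ hξ hξ'
    exact tendsto_nhds_unique (hξ'.comp hns'.tendsto_atTop) (hξ.mul_const _)
  filter_upwards [ae_all_iff.2 key] with ξ hξ
  obtain ⟨R, hR⟩ := exists_nat_ge ‖ξ‖
  exact hξ R (by simpa using hR)

omit hμ [IsUltrametricDist K] [Fact t.Prime] in
lemma memLp_dilate {ψ : K → ℂ} (hψ : MemLp ψ 2 μ) (j : ℤ) (k : ℕ) :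
    MemLp (W.dilate ψ j k) 2 μ :=
  ((hψ.comp_sub (W.u k)).comp_mul (zpow_ne_zero (-j) W.ϖ_ne_zero)).const_mul _

/-- Inner products with the wavelets at scale `j`, on the Fourier side. -/
lemma exists_innerL2_dilate {f : K → ℂ} (hf : MemLp f 2 μ) (j : ℤ) :
    ∃ h : K → ℂ, MemLp h 2 μ ∧ ∀ ψ g : K → ℂ, W.IsFourierL2 μ ψ g → ∀ k,
      innerL2 μ f (W.dilate ψ j k) = innerL2 μ h (fun ξ => W.e (-W.u k) ξ * g ξ) := by
  have h0 : W.ϖ ^ (-j) ≠ 0 := zpow_ne_zero _ W.ϖ_ne_zero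
  -- The dilation is moved from the wavelet to f by a change of variables whose Jacobian enters the
  -- constant; h is the Fourier transform of this rescaled f.
  have hf' := (hf.comp_mul (inv_ne_zero h0)).const_mul
    (((W.q ^ ((j : ℝ) / 2) : ℝ) : ℂ) * scale μ (W.ϖ ^ (-j)))
  obtain ⟨h, hh⟩ := W.exists_fourierL2 μ hμ hf'
  refine ⟨h, hh.2.1, fun ψ g hg k => ?_⟩
  rw [← W.innerL2_fourier μ hμ hh (hg.comp_sub (W.u k)), innerL2, innerL2]
  have h1 := integral_comp_mul μ h0 fun x => f ((W.ϖ ^ (-j))⁻¹ * x) *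
    (((W.q ^ ((j : ℝ) / 2) : ℝ) : ℂ) * starRingEnd ℂ (ψ (x - W.u k)))
  rw [← integral_const_mul] at h1
  refine Eq.trans (integral_congr_ae (ae_of_all _ fun x => ?_))
    (h1.trans (integral_congr_ae (ae_of_all _ fun x => ?_)))
  · simp only [dilate, map_mul, Complex.conj_ofReal, inv_mul_cancel_left₀ h0]
  · ring

end Setup

/-! ### Analysis operators of Bessel families -/

section Bessel

variable {ι H : Type*} [NormedAddCommGroup H] [InnerProductSpace ℂ H]

/-- The analysis operator of a Bessel family. -/
lemma exists_analysis {v : ι → H} {B : ℝ}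
    (hs : ∀ h, Summable fun p => ‖inner ℂ (v p) h‖ ^ 2)
    (hB : ∀ h, ∑' p, ‖inner ℂ (v p) h‖ ^ 2 ≤ B * ‖h‖ ^ 2) :
    ∃ V : H →L[ℂ] lp (fun _ : ι => ℂ) 2, ∀ h p, V h p = inner ℂ (v p) h := by
  have hmem : ∀ h, Memℓp (fun p => inner ℂ (v p) h) 2 := fun h =>
    memℓp_gen (by simpa using hs h)
  let V : H →ₗ[ℂ] lp (fun _ : ι => ℂ) 2 :=
    { toFun := fun h => ⟨fun p => inner ℂ (v p) h, hmem h⟩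
      map_add' := fun h h' => by
        ext p
        exact inner_add_right _ _ _
      map_smul' := fun a h => by
        ext p
        exact inner_smul_right _ _ _ }
  refine ⟨V.mkContinuous √B fun h => ?_, fun h p => rfl⟩
  have h1 : ‖V h‖ ^ 2 ≤ B * ‖h‖ ^ 2 := by
    refine le_trans (le_of_eq ?_) (hB h)
    have := lp.norm_rpow_eq_tsum (p := 2) (by simp) (V h)
    simp only [ENNReal.toReal_ofNat, Real.rpow_ofNat] at this
    exact this
  rw [← Real.sqrt_sq (norm_nonneg (V h)), ← Real.sqrt_sq (norm_nonneg h),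
    ← Real.sqrt_mul' _ (sq_nonneg _)]
  exact Real.sqrt_le_sqrt h1

/-- The adjoint of V' sends the p-th unit vector to `w p`, so the series is V'*V f; this vanishes
because the ranges of V and V' are orthogonal. -/
lemma hasSum_smul_of_bessel [CompleteSpace H] {v w : ι → H}
    {V V' : H →L[ℂ] lp (fun _ : ι => ℂ) 2} (hV : ∀ h p, V h p = inner ℂ (v p) h)
    (hV' : ∀ h p, V' h p = inner ℂ (w p) h)
    (h0 : ∀ f g, inner ℂ (V' g) (V f) = 0) (f : H) :
    HasSum (fun p => inner ℂ (v p) f • w p) 0 := by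
  classical
  have h1 : V'.adjoint (V f) = 0 := by
    refine ext_inner_left ℂ fun g => ?_
    rw [ContinuousLinearMap.adjoint_inner_right, h0, inner_zero_right]
  have h2 := (lp.hasSum_single (by simp) (V f)).mapL V'.adjoint
  rw [h1] at h2
  refine h2.congr_fun fun p => ?_
  refine ext_inner_left ℂ fun g => ?_
  rw [ContinuousLinearMap.adjoint_inner_right, lp.inner_single_right, inner_smul_right, hV, hV',
    RCLike.inner_apply, inner_conj_symm]

end Bessel

lemma norm_toLp_sq {X : Type*} [MeasurableSpace X] {μ : Measure X} {f : X → ℂ}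
    (hf : MemLp f 2 μ) : ‖hf.toLp f‖ ^ 2 = ∫ x, ‖f x‖ ^ 2 ∂μ := by
  have h2 : ∀ x, f x * starRingEnd ℂ (f x) = ((‖f x‖ ^ 2 : ℝ) : ℂ) := fun x => by
    rw [Complex.mul_conj, Complex.normSq_eq_norm_sq]
  rw [← inner_self_eq_norm_sq (𝕜 := ℂ), ← innerL2_eq_inner, innerL2]
  simp only [h2]
  rw [integral_complex_ofReal]
  exact Complex.ofReal_re _

/-! ### Periodic multipliers commute with the frame operator -/

namespace Setup

variable {K : Type*} [NontriviallyNormedField K] {t c : ℕ} [NeZero c] {W : Setup K t c}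
  [Fact t.Prime] [ProperSpace K] [MeasurableSpace K] [BorelSpace K] {μ : Measure K}
  [μ.IsAddHaarMeasure] [IsUltrametricDist K]

omit [ProperSpace K] [MeasurableSpace K] [BorelSpace K] in
lemma exists_equiv_u_add (W : Setup K t c) {v : K} (hv : v ∈ W.lattice) :
    ∃ σ : ℕ ≃ ℕ, ∀ k, W.u (σ k) = W.u k + v := by
  choose σ hσ using fun k => W.mem_lattice.1 (add_mem (W.u_mem k) hv)
  choose τ hτ using fun k => W.mem_lattice.1 (sub_mem (W.u_mem k) hv)
  exact ⟨⟨σ, τ, fun k => W.u_injective (by rw [hτ, hσ]; ring),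
    fun k => W.u_injective (by rw [hσ, hτ]; ring)⟩, hσ⟩

/-- A bounded measurable function invariant under the lattice. -/
structure IsBddPeriodic (W : Setup K t c) (μ : Measure K) (b : K → ℂ) : Prop where
  meas : AEStronglyMeasurable b μ
  bdd : ∀ᵐ x ∂μ, ‖b x‖ ≤ 1
  periodic : ∀ v ∈ W.lattice, ∀ᵐ x ∂μ, b (x + v) = b x

omit [ProperSpace K] [BorelSpace K] [μ.IsAddHaarMeasure] [IsUltrametricDist K] in
lemma IsBddPeriodic.conj {b : K → ℂ} (hb : W.IsBddPeriodic μ b) :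
    W.IsBddPeriodic μ fun x => starRingEnd ℂ (b x) where
  meas := RCLike.continuous_conj.comp_aestronglyMeasurable hb.meas
  bdd := hb.bdd.mono fun x hx => by simpa using hx
  periodic v hv := (hb.periodic v hv).mono fun x hx => by simp only [hx]

omit [ProperSpace K] [BorelSpace K] [μ.IsAddHaarMeasure] [IsUltrametricDist K] in
lemma IsBddPeriodic.memLp_mul {b f : K → ℂ} (hb : W.IsBddPeriodic μ b) (hf : MemLp f 2 μ) :
    MemLp (fun x => b x * f x) 2 μ := by
  refine hf.of_le (hb.meas.mul hf.1) (hb.bdd.mono fun x hx => ?_)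
  rw [norm_mul]
  exact mul_le_of_le_one_left (norm_nonneg _) hx

/-- The frame operator of a system of lattice modulations commutes with multiplication by bounded
periodic functions. -/
lemma inner_analysis_comm {g : K → ℂ} (hg : MemLp g 2 μ)
    {V : Lp ℂ 2 μ →L[ℂ] lp (fun _ : ℕ => ℂ) 2}
    (hV : ∀ h k, V h k = inner ℂ ((hg.e_mul W (-W.u k)).toLp _) h)
    {b : K → ℂ} (hb : W.IsBddPeriodic μ b) {h₁ h₂ : K → ℂ} (hh₁ : MemLp h₁ 2 μ)
    (hh₂ : MemLp h₂ 2 μ) :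
    inner ℂ (V (hh₂.toLp h₂)) (V ((hb.memLp_mul hh₁).toLp _)) =
      inner ℂ (V ((hb.conj.memLp_mul hh₂).toLp _)) (V (hh₁.toLp h₁)) := by
  set S : Lp ℂ 2 μ →L[ℂ] Lp ℂ 2 μ := V.adjoint ∘L V
  have hX := Lp.memLp (S (hh₁.toLp h₁))
  have hY := Lp.memLp (S (hh₂.toLp h₂))
  set X : K → ℂ := ⇑(S (hh₁.toLp h₁))
  set Y : K → ℂ := ⇑(S (hh₂.toLp h₂))
  have hleft : ∀ {a : K → ℂ} (ha : MemLp (fun x => a x * h₁ x) 2 μ),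
      inner ℂ (V (hh₂.toLp h₂)) (V (ha.toLp _)) =
        ∫ x, a x * (h₁ x * starRingEnd ℂ (Y x)) ∂μ := by
    intro a ha
    have h1 : hY.toLp Y = S (hh₂.toLp h₂) := Lp.toLp_coeFn _ _
    rw [← ContinuousLinearMap.adjoint_inner_left]
    change inner ℂ (S (hh₂.toLp h₂)) _ = _
    rw [← h1, ← innerL2_eq_inner, innerL2]
    simp only [mul_assoc]
  have hright : ∀ {a : K → ℂ} (ha : MemLp (fun x => starRingEnd ℂ (a x) * h₂ x) 2 μ),
      inner ℂ (V (ha.toLp _)) (V (hh₁.toLp h₁)) =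
        ∫ x, a x * (X x * starRingEnd ℂ (h₂ x)) ∂μ := by
    intro a ha
    have h1 : hX.toLp X = S (hh₁.toLp h₁) := Lp.toLp_coeFn _ _
    rw [← ContinuousLinearMap.adjoint_inner_right]
    change inner ℂ _ (S (hh₁.toLp h₁)) = _
    rw [← h1, ← innerL2_eq_inner, innerL2]
    congr 1
    ext x
    simp only [map_mul, Complex.conj_conj]
    ring
  have hintY : Integrable (fun x => h₁ x * starRingEnd ℂ (Y x)) μ := hh₁.integrable_mul hY.star
  have hintX : Integrable (fun x => X x * starRingEnd ℂ (h₂ x)) μ := hX.integrable_mul hh₂.star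
  rw [hleft, hright, ← sub_eq_zero,
    ← integral_sub (hintY.bdd_mul hb.meas hb.bdd) (hintX.bdd_mul hb.meas hb.bdd)]
  simp only [← mul_sub]
  -- This reduces b to the characters χ(v·) with v ∈ Λ, for which modulation turns the k-th
  -- coefficient into the one at `u k + v`; reindexing by `σ` matches the two series.
  refine W.integral_mul_eq_zero_of_periodic μ (hintY.sub hintX) (fun v hv => ?_) hb.meas hb.bdd
    hb.periodic
  simp only [mul_sub]
  rw [integral_sub (W.integrable_e_mul v hintY) (W.integrable_e_mul v hintX), sub_eq_zero,
    ← hleft (hh₁.e_mul W v), ← hright (by simpa only [conj_e] using hh₂.e_mul W (-v)),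
    lp.inner_eq_tsum, lp.inner_eq_tsum]
  obtain ⟨σ, hσ⟩ := W.exists_equiv_u_add hv
  have hcoef : ∀ {f : K → ℂ} (hf : MemLp f 2 μ) (k : ℕ),
      V (hf.toLp f) k = ∫ x, f x * starRingEnd ℂ (W.e (-W.u k) x * g x) ∂μ := by
    intro f hf k
    rw [hV, ← innerL2_eq_inner, innerL2]
  refine (tsum_congr fun k => ?_).trans (σ.tsum_eq _)
  rw [RCLike.inner_apply, RCLike.inner_apply, hcoef, hcoef, hcoef, hcoef]
  congr 1
  · congr 1
    ext x
    simp only [map_mul, conj_e, hσ, neg_neg, e_add_left]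
    ring
  · congr 2
    ext x
    have h1 : W.e (-v) x * W.e v x = 1 := by rw [← e_add_left, neg_add_cancel, e_zero_left]
    simp only [map_mul, conj_e, hσ, neg_neg, e_add_left]
    linear_combination -(W.e (W.u k) x * h₂ x * starRingEnd ℂ (g x)) * h1

end Setup

/-! ### Regrouping of sums and weighted Gram sums -/

lemma hasSum_prod_of_fintype {L κ E : Type*} [Fintype L] [AddCommMonoid E] [TopologicalSpace E]
    [ContinuousAdd E] {f : L × κ → E} {s : L → E}
    (h : ∀ l, HasSum (fun k => f (l, k)) (s l)) : HasSum f (∑ l, s l) := by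
  classical
  have h1 : ∀ l ∈ Finset.univ, HasSum (fun p : L × κ => if p.1 = l then f p else 0) (s l) := by
    intro l _
    rw [← (Prod.mk_right_injective l).hasSum_iff]
    · simpa [Function.comp_def] using h l
    · rintro ⟨l', k⟩ hp
      rw [if_neg]
      rintro rfl
      exact hp ⟨k, rfl⟩
  simpa using hasSum_sum h1

/-- Resummation of a nonnegative family along the groups of indices sharing `n` and `j`. -/
lemma hasSum_of_hasSum_fiber {α β γ δ : Type*} {F : (α × γ) × β × δ → ℝ} {G : α × β × δ → ℝ}
    {T : ℝ} (hF : ∀ p, 0 ≤ F p) (hG : HasSum G T)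
    (h : ∀ n j, HasSum (fun q : γ × δ => F ((n, q.1), (j, q.2))) (∑' k, G (n, j, k))) :
    HasSum F T := by
  have hG' := (Equiv.prodAssoc α β δ).hasSum_iff.2 hG
  rw [← (Equiv.prodProdProdComm α β γ δ).hasSum_iff]
  have h1 : ∀ p : α × β, ∑' q : γ × δ, (F ∘ Equiv.prodProdProdComm α β γ δ) (p, q) =
      ∑' k, (G ∘ Equiv.prodAssoc α β δ) (p, k) := fun p => (h p.1 p.2).tsum_eq
  have hsum : Summable (F ∘ Equiv.prodProdProdComm α β γ δ) := by
    refine (summable_prod_of_nonneg fun p => hF _).2 ⟨fun p => (h p.1 p.2).summable, ?_⟩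
    exact (summable_congr h1).2 hG'.summable.prod
  have h2 := hG'.prod_fiberwise fun p => (hG'.summable.prod_factor p).hasSum
  have h3 := hsum.hasSum.prod_fiberwise fun p => (hsum.prod_factor p).hasSum
  rw [h2.unique (h3.congr_fun fun p => (h1 p).symm)]
  exact hsum.hasSum

/-- A convergent sum vanishes if its partial sums over the groups of indices sharing `n` and `j`
vanish. -/
lemma hasSum_eq_zero_of_fiber {α β γ δ : Type*} [Fintype γ] {F : (α × γ) × β × δ → ℂ} {T : ℂ}
    (hF : HasSum F T)
    (h : ∀ n j, HasSum (fun q : γ × δ => F ((n, q.1), (j, q.2))) 0) : T = 0 := by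
  rw [← (Equiv.prodProdProdComm α β γ δ).hasSum_iff] at hF
  exact (hF.prod_fiberwise fun p => h p.1 p.2).unique hasSum_zero

namespace Setup

variable {K : Type*} [NontriviallyNormedField K] {t c : ℕ} [NeZero c] {W : Setup K t c}
  [Fact t.Prime] [ProperSpace K] [MeasurableSpace K] [BorelSpace K] {μ : Measure K}
  [μ.IsAddHaarMeasure] [IsUltrametricDist K]

omit [ProperSpace K] [BorelSpace K] [μ.IsAddHaarMeasure] [IsUltrametricDist K] in
lemma IsBddPeriodic.mul {a b : K → ℂ} (ha : W.IsBddPeriodic μ a) (hb : W.IsBddPeriodic μ b) :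
    W.IsBddPeriodic μ fun x => a x * b x where
  meas := ha.meas.mul hb.meas
  bdd := by
    filter_upwards [ha.bdd, hb.bdd] with x h1 h2
    rw [norm_mul]
    exact mul_le_one₀ h1 (norm_nonneg _) h2
  periodic v hv := by
    filter_upwards [ha.periodic v hv, hb.periodic v hv] with x h1 h2
    rw [h1, h2]

/-- Each weight on g moves, conjugated, to h₁ or h₂. Commutation with the frame operator then brings
the weight of h₁ over to h₂, where the sum over l collapses to γ; it comes out conjugated from the
conjugate-linear slot. -/
lemma exists_hasSum_gram {g : K → ℂ} (hg : MemLp g 2 μ)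
    (hB : ∀ h : K → ℂ, MemLp h 2 μ →
      Summable (fun k => ‖innerL2 μ h (fun x => W.e (-W.u k) x * g x)‖ ^ 2) ∧
      ∑' k, ‖innerL2 μ h (fun x => W.e (-W.u k) x * g x)‖ ^ 2 ≤ ∫ x, ‖h x‖ ^ 2 ∂μ)
    {L : Type*} [Fintype L] {α β : L → K → ℂ} (hα : ∀ l, W.IsBddPeriodic μ (α l))
    (hβ : ∀ l, W.IsBddPeriodic μ (β l)) {γ : ℂ}
    (hγ : ∀ᵐ x ∂μ, ∑ l, α l x * starRingEnd ℂ (β l x) = γ) {h₁ h₂ : K → ℂ}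
    (hh₁ : MemLp h₁ 2 μ) (hh₂ : MemLp h₂ 2 μ) :
    HasSum (fun q : L × ℕ => innerL2 μ h₁ (fun x => W.e (-W.u q.2) x * (α q.1 x * g x)) *
        starRingEnd ℂ (innerL2 μ h₂ (fun x => W.e (-W.u q.2) x * (β q.1 x * g x))))
      (starRingEnd ℂ γ * ∑' k, innerL2 μ h₁ (fun x => W.e (-W.u k) x * g x) *
        starRingEnd ℂ (innerL2 μ h₂ (fun x => W.e (-W.u k) x * g x))) := by
  have hgk : ∀ k, MemLp (fun x => W.e (-W.u k) x * g x) 2 μ := fun k => hg.e_mul W _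
  obtain ⟨V, hV⟩ := exists_analysis (v := fun k => (hgk k).toLp _) (B := 1)
    (fun h => by
      have := (hB h (Lp.memLp h)).1
      simpa only [innerL2_eq_inner (Lp.memLp h) (hgk _), Lp.toLp_coeFn] using this)
    (fun h => by
      have := (hB h (Lp.memLp h)).2
      rw [← norm_toLp_sq (Lp.memLp h)] at this
      simpa only [innerL2_eq_inner (Lp.memLp h) (hgk _), Lp.toLp_coeFn, one_mul] using this)
  have hcoef : ∀ {f : K → ℂ} (hf : MemLp f 2 μ) (k : ℕ),
      V (hf.toLp f) k = innerL2 μ f (fun x => W.e (-W.u k) x * g x) := by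
    intro f hf k
    rw [hV, innerL2_eq_inner hf (hgk k)]
  have hmove : ∀ (a f : K → ℂ) (k : ℕ), innerL2 μ f (fun x => W.e (-W.u k) x * (a x * g x)) =
      innerL2 μ (fun x => starRingEnd ℂ (a x) * f x) (fun x => W.e (-W.u k) x * g x) := by
    intro a f k
    unfold innerL2
    congr 1
    ext x
    simp only [map_mul]
    ring
  have hm : ∀ l, MemLp (fun x => α l x * starRingEnd ℂ (β l x) * h₂ x) 2 μ := fun l =>
    ((hα l).mul (hβ l).conj).memLp_mul hh₂
  have hsum : ∑ l, (hm l).toLp _ = γ • hh₂.toLp h₂ := by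
    refine Lp.ext ?_
    filter_upwards [Lp.coeFn_finsetSum Finset.univ fun l => (hm l).toLp _,
      ae_all_iff.2 fun l => (hm l).coeFn_toLp, Lp.coeFn_smul γ (hh₂.toLp h₂), hh₂.coeFn_toLp, hγ]
      with x h1 h2 h3 h4 h5
    rw [h1, h3, Finset.sum_apply, Pi.smul_apply, h4, smul_eq_mul, ← h5, Finset.sum_mul]
    exact Finset.sum_congr rfl fun l _ => h2 l
  have hfib : ∀ l, HasSum (fun k => innerL2 μ h₁ (fun x => W.e (-W.u k) x * (α l x * g x)) *
        starRingEnd ℂ (innerL2 μ h₂ (fun x => W.e (-W.u k) x * (β l x * g x))))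
      (inner ℂ (V ((hm l).toLp _)) (V (hh₁.toLp h₁))) := by
    intro l
    have h1 := lp.hasSum_inner (𝕜 := ℂ) (G := fun _ : ℕ => ℂ) (V (((hβ l).conj.memLp_mul hh₂).toLp _))
      (V (((hα l).conj.memLp_mul hh₁).toLp _))
    rw [inner_analysis_comm hg hV (hα l).conj hh₁ ((hβ l).conj.memLp_mul hh₂)] at h1
    simp only [RCLike.inner_apply, hcoef, Complex.conj_conj, ← mul_assoc] at h1
    simpa only [hmove] using h1
  have h2 := hasSum_prod_of_fintype (f := fun q : L × ℕ =>
    innerL2 μ h₁ (fun x => W.e (-W.u q.2) x * (α q.1 x * g x)) *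
        starRingEnd ℂ (innerL2 μ h₂ (fun x => W.e (-W.u q.2) x * (β q.1 x * g x)))) hfib
  rw [← sum_inner, ← map_sum, hsum, map_smul, inner_smul_left, lp.inner_eq_tsum] at h2
  simpa only [RCLike.inner_apply, hcoef] using h2

end Setup

lemma summable_slice {α β δ : Type*} {G : α × β × δ → ℝ} (hG : Summable G) (h0 : ∀ p, 0 ≤ G p)
    (a : α) (b : β) :
    Summable (fun k => G (a, b, k)) ∧ ∑' k, G (a, b, k) ≤ ∑' p, G p := by
  have hinj : Function.Injective fun k : δ => (a, b, k) := fun k k' h => by simpa using h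
  exact ⟨hG.comp_injective hinj, tsum_comp_le_tsum_of_inj hG h0 hinj⟩

/-! ### Paraunitary weights and Gram sums at one scale -/

namespace Setup

variable {K : Type*} [NontriviallyNormedField K] {t c : ℕ} [NeZero c] {W : Setup K t c}
  [Fact t.Prime] [ProperSpace K] [MeasurableSpace K] [BorelSpace K] {μ : Measure K}
  [μ.IsAddHaarMeasure]

/-- The substitution ξ = ϖx turns the period ϖu(k) into u(k), and entries of unitary matrices have
modulus at most 1. -/
lemma mask_entry_isBddPeriodic {L : ℕ} {A : K → Matrix (Fin L) (Fin L) ℂ}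
    (hA : IsParaunitary μ A) (hper : ∀ ℓ r, W.IsIntegralPeriodic μ (fun ξ => A ξ ℓ r))
    (ℓ r : Fin L) : W.IsBddPeriodic μ fun x => A (W.ϖ * x) ℓ r where
  meas := (hA.1 ℓ r).comp_quasiMeasurePreserving (quasiMeasurePreserving_mul μ W.ϖ_ne_zero)
  bdd := by
    filter_upwards [(quasiMeasurePreserving_mul μ W.ϖ_ne_zero).ae hA.2] with x hx
    exact entry_norm_bound_of_unitary hx ℓ r
  periodic v hv := by
    obtain ⟨k, rfl⟩ := hv
    filter_upwards [(quasiMeasurePreserving_mul μ W.ϖ_ne_zero).ae (hper ℓ r k)] with x hx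
    rw [mul_add, hx]

/-- This is orthonormality of the columns, A*A = 1, read at ϖx. -/
lemma ae_sum_mul_conj {L : ℕ} {A : K → Matrix (Fin L) (Fin L) ℂ}
    (hA : IsParaunitary μ A) (r r' : Fin L) : ∀ᵐ x ∂μ,
      ∑ ℓ, A (W.ϖ * x) ℓ r * starRingEnd ℂ (A (W.ϖ * x) ℓ r') = if r = r' then 1 else 0 := by
  filter_upwards [(quasiMeasurePreserving_mul μ W.ϖ_ne_zero).ae hA.2] with x hx
  have h1 := congrFun (congrFun (Matrix.mem_unitaryGroup_iff'.1 hx) r') r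
  rw [Matrix.mul_apply, Matrix.one_apply] at h1
  simp only [eq_comm (a := r)]
  rw [← h1]
  refine Finset.sum_congr rfl fun ℓ _ => ?_
  rw [Matrix.star_apply, mul_comm]
  rfl

variable [IsUltrametricDist K]

omit [Fact t.Prime] [ProperSpace K] [BorelSpace K] [μ.IsAddHaarMeasure] [IsUltrametricDist K] in
lemma innerL2_congr_right {f g g' : K → ℂ} (h : g =ᵐ[μ] g') : innerL2 μ f g = innerL2 μ f g' := by
  refine integral_congr_ae ?_
  filter_upwards [h] with x hx
  rw [hx]

/-- The cross Gram sums of the new systems at a given scale. -/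
lemma hasSum_innerL2_dilate (hμ : μ (Metric.closedBall 0 1) = 1) {ψ ψhat : K → ℂ}
    (hψ : W.IsFourierL2 μ ψ ψhat)
    (hB : ∀ f : K → ℂ, MemLp f 2 μ →
      Summable (fun k => ‖innerL2 μ f (W.dilate ψ 0 k)‖ ^ 2) ∧
      ∑' k, ‖innerL2 μ f (W.dilate ψ 0 k)‖ ^ 2 ≤ ∫ x, ‖f x‖ ^ 2 ∂μ)
    {L : ℕ} {A : K → Matrix (Fin L) (Fin L) ℂ} (hA : IsParaunitary μ A)
    (hper : ∀ ℓ r, W.IsIntegralPeriodic μ (fun ξ => A ξ ℓ r)) {Ψ Ψhat : Fin L → Fin L → K → ℂ}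
    (hΨ : ∀ r ℓ, W.IsFourierL2 μ (Ψ r ℓ) (Ψhat r ℓ))
    (hΨA : ∀ r ℓ, Ψhat r ℓ =ᵐ[μ] fun x => A (W.ϖ * x) ℓ r * ψhat x) (r r' : Fin L) (j : ℤ)
    {f₁ f₂ : K → ℂ} (hf₁ : MemLp f₁ 2 μ) (hf₂ : MemLp f₂ 2 μ) :
    HasSum (fun q : Fin L × ℕ => innerL2 μ f₁ (W.dilate (Ψ r q.1) j q.2) *
        starRingEnd ℂ (innerL2 μ f₂ (W.dilate (Ψ r' q.1) j q.2)))
      (if r = r' then ∑' k, innerL2 μ f₁ (W.dilate ψ j k) *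
        starRingEnd ℂ (innerL2 μ f₂ (W.dilate ψ j k)) else 0) := by
  -- Since the scale is absorbed into h₁ and h₂, the Bessel bound at scale 0 suffices for all j.
  have hB' : ∀ h : K → ℂ, MemLp h 2 μ →
      Summable (fun k => ‖innerL2 μ h (fun x => W.e (-W.u k) x * ψhat x)‖ ^ 2) ∧
      ∑' k, ‖innerL2 μ h (fun x => W.e (-W.u k) x * ψhat x)‖ ^ 2 ≤ ∫ x, ‖h x‖ ^ 2 ∂μ := by
    intro h hh
    obtain ⟨f, hf⟩ := W.exists_fourierL2_symm μ hμ hh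
    have h1 : ∀ k, innerL2 μ f (W.dilate ψ 0 k) =
        innerL2 μ h (fun x => W.e (-W.u k) x * ψhat x) := by
      intro k
      rw [← W.innerL2_fourier μ hμ hf (hψ.comp_sub (W.u k))]
      congr 1
      ext x
      simp [dilate]
    have h2 : ∫ x, ‖f x‖ ^ 2 ∂μ = ∫ x, ‖h x‖ ^ 2 ∂μ := by
      rw [← norm_toLp_sq hf.1, ← norm_toLp_sq hf.2.1, ← (W.isFourierL2_iff μ hμ hf.1 hf.2.1).1 hf,
        LinearIsometryEquiv.norm_map]
    simpa only [h1, h2] using hB f hf.1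
  obtain ⟨h₁, hh₁, H₁⟩ := exists_innerL2_dilate (W := W) hμ hf₁ j
  obtain ⟨h₂, hh₂, H₂⟩ := exists_innerL2_dilate (W := W) hμ hf₂ j
  have key := exists_hasSum_gram hψ.2.1 hB'
    (α := fun ℓ x => A (W.ϖ * x) ℓ r) (β := fun ℓ x => A (W.ϖ * x) ℓ r')
    (fun ℓ => mask_entry_isBddPeriodic hA hper ℓ r)
    (fun ℓ => mask_entry_isBddPeriodic hA hper ℓ r')
    (ae_sum_mul_conj (W := W) hA r r') hh₁ hh₂
  have hcongr : ∀ (h : K → ℂ) (s ℓ : Fin L) (k : ℕ),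
      innerL2 μ h (fun x => W.e (-W.u k) x * Ψhat s ℓ x) =
        innerL2 μ h (fun x => W.e (-W.u k) x * (A (W.ϖ * x) ℓ s * ψhat x)) := by
    intro h s ℓ k
    refine innerL2_congr_right ?_
    filter_upwards [hΨA s ℓ] with x hx
    rw [hx]
  simp only [H₁ _ _ hψ, H₂ _ _ hψ, H₁ _ _ (hΨ _ _), H₂ _ _ (hΨ _ _), hcongr]
  convert key using 1
  split_ifs <;> simp

end Setup

end LocalFieldWavelet

end

/-! ### The main theorem -/

open MeasureTheory LocalFieldWavelet in
theorem theorem3p6 {K : Type*} [NontriviallyNormedField K] [IsUltrametricDist K]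
    [LocallyCompactSpace K] [MeasurableSpace K] [BorelSpace K]
    (t c : ℕ) [Fact t.Prime] [CharP K t] [NeZero c] (W : Setup K t c)
    (μ : Measure K) [μ.IsAddHaarMeasure] (hμ : μ (Metric.closedBall 0 1) = 1)
    (L N : ℕ)
    -- the refinable function, its Fourier transform, the wavelets and the masks
    (φ φhat : K → ℂ) (hφ : W.IsFourierL2 μ φ φhat)
    (ψ : Fin N → K → ℂ) (hψ : ∀ n, MemLp (ψ n) 2 μ)
    (d : Fin (N + 1) → ℕ → ℂ) (m : Fin (N + 1) → K → ℂ)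
    (hmask : ∀ n, W.IsMask μ (d n) (m n))
    (hrefine : W.TwoScale μ φ (d 0) φ)
    (hwavelet : ∀ n : Fin N, W.TwoScale μ φ (d n.succ) (ψ n))
    (hM : ∀ k : ℕ, 1 ≤ k → k ≤ t ^ c - 1 → ∀ᵐ ξ ∂μ,
      (W.maskMatrix m k ξ).conjTranspose * W.maskMatrix m k ξ = 1)
    (hframe : W.IsNormalizedFrame μ ψ)
    -- the paraunitary matrix
    (A : K → Matrix (Fin L) (Fin L) ℂ) (hA : Setup.IsParaunitary μ A)
    (hper : ∀ ℓ r, W.IsIntegralPeriodic μ (fun ξ => A ξ ℓ r)) :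
    -- the functions with the prescribed Fourier transforms exist
    (∃ Ψ : Fin L → Fin N × Fin L → K → ℂ, ∀ r i, ∃ g : K → ℂ, W.IsFourierL2 μ (Ψ r i) g ∧
      ∀ᵐ ξ ∂μ, g (W.ϖ⁻¹ * ξ) = Setup.newMask A m r i ξ * φhat ξ) ∧
    -- and they generate tight, pairwise orthogonal wavelet frames
    ∀ Ψ : Fin L → Fin N × Fin L → K → ℂ,
      (∀ r i, ∃ g : K → ℂ, W.IsFourierL2 μ (Ψ r i) g ∧
        ∀ᵐ ξ ∂μ, g (W.ϖ⁻¹ * ξ) = Setup.newMask A m r i ξ * φhat ξ) →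
      (∀ r, W.IsTightFrame μ (Ψ r)) ∧
      ∀ r r', r ≠ r' → W.AreOrthogonal μ (Ψ r) (Ψ r') := by
  have : ProperSpace K := ProperSpace.of_locallyCompactSpace K
  have h0 := W.ϖ_ne_zero
  choose ψhat hψhat using fun n => W.exists_fourierL2 μ hμ (hψ n)
  have hmul : ∀ n, ∀ᵐ ξ ∂μ, ψhat n (W.ϖ⁻¹ * ξ) = m n.succ ξ * φhat ξ := fun n =>
    Setup.fourier_twoScale hμ hφ (hψhat n) (hmask _) (hwavelet n)
  have hAper := fun ℓ r => Setup.mask_entry_isBddPeriodic hA hper ℓ r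
  refine ⟨?_, fun Ψ hΨ => ?_⟩
  -- The prescribed transform is a bounded multiple of ψ̂_n, hence in L², and can be inverted.
  · choose Ψ hΨ using fun (r : Fin L) (i : Fin N × Fin L) =>
      W.exists_fourierL2_symm μ hμ ((hAper i.2 r).memLp_mul (hψhat i.1).2.1)
    refine ⟨Ψ, fun r i => ⟨_, hΨ r i, ?_⟩⟩
    filter_upwards [hmul i.1] with ξ hξ
    rw [mul_inv_cancel_left₀ h0, hξ, Setup.newMask, mul_assoc]
  choose Ψhat hΨhat hΨmul using hΨ
  have hΨA : ∀ r i, Ψhat r i =ᵐ[μ] fun x => A (W.ϖ * x) i.2 r * ψhat i.1 x := by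
    intro r i
    filter_upwards [(quasiMeasurePreserving_mul μ h0).ae (hΨmul r i),
      (quasiMeasurePreserving_mul μ h0).ae (hmul i.1)] with x h1 h2
    rw [inv_mul_cancel_left₀ h0] at h1 h2
    rw [h1, h2, Setup.newMask, mul_assoc]
  have hB : ∀ n, ∀ f : K → ℂ, MemLp f 2 μ →
      Summable (fun k => ‖innerL2 μ f (W.dilate (ψ n) 0 k)‖ ^ 2) ∧
      ∑' k, ‖innerL2 μ f (W.dilate (ψ n) 0 k)‖ ^ 2 ≤ ∫ x, ‖f x‖ ^ 2 ∂μ := by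
    intro n f hf
    obtain ⟨h1, -, h2⟩ := hframe.2 f hf
    rw [one_mul] at h2
    obtain ⟨h3, h4⟩ := summable_slice h1 (fun _ => sq_nonneg _) n 0
    exact ⟨h3, h4.trans h2⟩
  have hgram := fun (r r' : Fin L) (n : Fin N) (j : ℤ) (f₁ f₂ : K → ℂ) (hf₁ : MemLp f₁ 2 μ)
      (hf₂ : MemLp f₂ 2 μ) =>
    Setup.hasSum_innerL2_dilate hμ (hψhat n) (hB n) hA hper
      (Ψ := fun r ℓ => Ψ r (n, ℓ)) (fun r ℓ => hΨhat r (n, ℓ)) (fun r ℓ => hΨA r (n, ℓ)) r r' j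
      hf₁ hf₂
  have hsq : ∀ z : ℂ, z * starRingEnd ℂ z = ((‖z‖ ^ 2 : ℝ) : ℂ) := fun z => by
    rw [Complex.mul_conj, Complex.normSq_eq_norm_sq]
  have htight : ∀ r, ∀ f : K → ℂ, MemLp f 2 μ → HasSum (fun p : (Fin N × Fin L) × ℤ × ℕ =>
      ‖innerL2 μ f (W.dilate (Ψ r p.1) p.2.1 p.2.2)‖ ^ 2) (∫ x, ‖f x‖ ^ 2 ∂μ) := by
    intro r f hf
    obtain ⟨h1, h2, h3⟩ := hframe.2 f hf
    rw [one_mul] at h2 h3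
    have h4 := h1.hasSum
    rw [le_antisymm h3 h2] at h4
    -- For each n and j the sum over ℓ and k equals the original sum over k, so the Parseval
    -- identity carries over with constant 1.
    refine hasSum_of_hasSum_fiber (fun _ => sq_nonneg _) h4 fun n j => ?_
    have h5 := hgram r r n j f f hf hf
    simp only [if_true, hsq] at h5
    rw [← Complex.ofReal_tsum] at h5
    exact Complex.hasSum_ofReal.1 h5
  refine ⟨fun r => ⟨1, one_pos, fun i => (hΨhat r i).1, fun f hf => ?_⟩, fun r r' hr f hf => ?_⟩
  · have h1 := htight r f hf
    rw [h1.tsum_eq, one_mul]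
    exact ⟨h1.summable, le_rfl, le_rfl⟩
  have hmem : ∀ (r : Fin L) (p : (Fin N × Fin L) × ℤ × ℕ),
      MemLp (W.dilate (Ψ r p.1) p.2.1 p.2.2) 2 μ :=
    fun r p => Setup.memLp_dilate (hΨhat r p.1).1 _ _
  have hanalysis : ∀ r, ∃ V : Lp ℂ 2 μ →L[ℂ] lp (fun _ : (Fin N × Fin L) × ℤ × ℕ => ℂ) 2,
      ∀ h p, V h p = inner ℂ ((hmem r p).toLp _) h := by
    intro r
    refine exists_analysis (B := 1) (fun h => ?_) (fun h => ?_)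
    · have := (htight r h (Lp.memLp h)).summable
      simpa only [innerL2_eq_inner (Lp.memLp h) (hmem r _), Lp.toLp_coeFn] using this
    · have := (htight r h (Lp.memLp h)).tsum_eq.le
      rw [← norm_toLp_sq (Lp.memLp h)] at this
      simpa only [innerL2_eq_inner (Lp.memLp h) (hmem r _), Lp.toLp_coeFn, one_mul] using this
  obtain ⟨V, hV⟩ := hanalysis r
  obtain ⟨V', hV'⟩ := hanalysis r'
  have horth : ∀ f g, inner ℂ (V' g) (V f) = 0 := by
    intro f g
    -- The inner product of the coefficient sequences splits into blocks indexed by (n, j), each a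
    -- mixed Gram sum with r ≠ r'.
    refine hasSum_eq_zero_of_fiber
      (lp.hasSum_inner (𝕜 := ℂ) (G := fun _ : (Fin N × Fin L) × ℤ × ℕ => ℂ) (V' g) (V f))
      fun n j => ?_
    have h1 := hgram r r' n j f g (Lp.memLp f) (Lp.memLp g)
    rw [if_neg hr] at h1
    refine h1.congr_fun fun q => ?_
    rw [RCLike.inner_apply, hV, hV', innerL2_eq_inner (Lp.memLp f) (hmem r ((n, q.1), (j, q.2))),
      innerL2_eq_inner (Lp.memLp g) (hmem r' ((n, q.1), (j, q.2))), Lp.toLp_coeFn, Lp.toLp_coeFn]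
  have hsum := hasSum_smul_of_bessel hV hV' horth (hf.toLp f)
  have h1 := (Lp.tendsto_Lp_iff_tendsto_eLpNorm' _ _).1 hsum
  refine h1.congr fun s => eLpNorm_congr_ae ?_
  filter_upwards [Lp.coeFn_zero ℂ 2 μ, Lp.coeFn_finsetSum s fun p =>
      inner ℂ ((hmem r p).toLp _) (hf.toLp f) • (hmem r' p).toLp _,
    ae_all_iff.2 fun p => Lp.coeFn_smul (inner ℂ ((hmem r p).toLp _) (hf.toLp f))
      ((hmem r' p).toLp _), ae_all_iff.2 fun p => (hmem r' p).coeFn_toLp] with x h2 h3 h4 h5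
  rw [Pi.sub_apply, h2, h3, Finset.sum_apply, Pi.zero_apply, sub_zero]
  refine Finset.sum_congr rfl fun p _ => ?_
  rw [h4 p, Pi.smul_apply, h5 p, smul_eq_mul, innerL2_eq_inner hf (hmem r p)]
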